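/- Let \(X,X_1,X_2,\dots\) be i.i.d. \(\mathbb{Z}\)-valued random variables such that, for some \(\sigma,\delta>0\), \(E(X)=0\), \(E(X^2)=\sigma^2\) and \(E(e^{\delta|X|})<\infty\). Let \(S_0=0\), \(S_k=S_{k-1}+X_k\), and suppose that the random walk \(S\) is irreducible on \(\mathbb{Z}\) (every site is reached from \(0\) with positive probability) and aperiodic (\(\gcd\{k\geq 1: P(S_k=0)>0\}=1\)). Let \(a_*=\inf\{t\in\mathbb{R}: E(e^{tX})<\infty\}\in[-\infty,0)\) and \(b_*=\sup\{t\in\mathbb{R}: E(e^{tX})<\infty\}\in(0,+\infty]\), let \(H(t)=\ln E(e^{tX})\) for \(t\in(a_*,b_*)\) and \(I(x)=\sup_{t\in(a_*,b_*)}\bigl(tx-H(t)\bigr)\), and fix \(a,b\in\mathbb{R}\) with \(a_*<a<b<b_*\). Let \(h\in C^2([0,1])\) be a non-negative concave function with \(h(0)=0\), \(h''<0\) on \([0,1]\) and \(h'([0,1])\subset H'([a,b])\). Set \(h_n(k)=nh(k/n)\) for \(k=0,\dots,n\). Then \(I(h'(s))\) is finite for every \(s\in[0,1]\), \(s\mapsto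 I(h'(s))\) is integrable on \([0,1]\), and there are \(c_+\geq c_->0\) and \(n_0\geq 1\) such that, for every \(n\geq n_0\), \[ e^{-c_+n^{1/3}}\leq e^{n\int_0^1 I(h'(s))\,ds}\,P\bigl(S_k\geq h_n(k)\ \forall k\in\{0,\dots,n\},\ S_n=\lceil h_n(n)\rceil\bigr)\leq e^{-c_-n^{1/3}}. \] -/

import Mathlib

open MeasureTheory ProbabilityTheory

noncomputable section

namespace ObstacleWalk

/-- `S_k = X_1 + ⋯ + X_k`, `S_0 = 0`; the increments are indexed from `0`, so `X i` is `X_{i+1}`. -/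
def walk {Ω : Type*} (X : ℕ → Ω → ℤ) (k : ℕ) (ω : Ω) : ℤ :=
  ∑ i ∈ Finset.range k, X i ω

/-- The walk is irreducible on `ℤ`: from `0` (hence, by translation invariance, from any site) it
visits every site with positive probability. -/
def IsIrreducibleWalk {Ω : Type*} [MeasurableSpace Ω] (X : ℕ → Ω → ℤ) (P : Measure Ω) : Prop :=
  ∀ x : ℤ, ∃ k : ℕ, 0 < P {ω | walk X k ω = x}

/-- The walk is aperiodic: the greatest common divisor of its possible return times
`{k ≥ 1 | P(S_k = 0) > 0}` is `1`. -/
def IsAperiodicWalk {Ω : Type*} [MeasurableSpace Ω] (X : ℕ → Ω → ℤ) (P : Measure Ω) : Prop :=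
  ∀ d : ℕ, (∀ k : ℕ, 1 ≤ k → 0 < P {ω | walk X k ω = 0} → d ∣ k) → d = 1

/-- `a_* = inf {t : ℝ | E(e^{tY}) < ∞}`, which may be `-∞`. -/
def lowerTilt {Ω : Type*} [MeasurableSpace Ω] (Y : Ω → ℝ) (P : Measure Ω) : EReal :=
  sInf ((fun t : ℝ => (t : EReal)) '' integrableExpSet Y P)

/-- `b_* = sup {t : ℝ | E(e^{tY}) < ∞}`, which may be `+∞`. -/
def upperTilt {Ω : Type*} [MeasurableSpace Ω] (Y : Ω → ℝ) (P : Measure Ω) : EReal :=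
  sSup ((fun t : ℝ => (t : EReal)) '' integrableExpSet Y P)

/-- The values `t x - H(t)`, `t ∈ (a_*, b_*)`, with `H = log E(e^{tY})`. -/
def legendreValues {Ω : Type*} [MeasurableSpace Ω] (Y : Ω → ℝ) (P : Measure Ω) (x : ℝ) : Set ℝ :=
  {y | ∃ t : ℝ, lowerTilt Y P < (t : EReal) ∧ (t : EReal) < upperTilt Y P ∧
    y = t * x - cgf Y P t}

/-- The Legendre–Fenchel transform `I(x) = sup_t (t x - H(t))` (meaningful where the supremum is
finite). -/
def rate {Ω : Type*} [MeasurableSpace Ω] (Y : Ω → ℝ) (P : Measure Ω) (x : ℝ) : ℝ :=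
  sSup (legendreValues Y P x)

/-- The derivative of a function on the closed interval `[0,1]` (one-sided at the endpoints). -/
def unitDeriv (h : ℝ → ℝ) : ℝ → ℝ :=
  derivWithin h (Set.Icc 0 1)

/-- The rescaled obstacle `h_n(k) = n h(k/n)`. -/
def obstacle (h : ℝ → ℝ) (n k : ℕ) : ℝ :=
  (n : ℝ) * h ((k : ℝ) / (n : ℝ))

/-- The event `{S ≥ h_n, S_n = ⌈h_n(n)⌉}`. -/
def aboveEvent {Ω : Type*} (X : ℕ → Ω → ℤ) (h : ℝ → ℝ) (n : ℕ) : Set Ω :=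
  {ω | (∀ k : ℕ, k ≤ n → obstacle h n k ≤ (walk X k ω : ℝ)) ∧ walk X n ω = ⌈obstacle h n n⌉}

end ObstacleWalk

end

/-!
Tilting the step from `k` to `k + 1` by the `τ (k + 1)` with `H'(τ (k + 1)) = c (k + 1) - c k`,
where `c = h_n`, centres the walk around the obstacle. The exponential weight this produces is
`exp (-∑ I (c (k + 1) - c k))`, which is `exp (-n ∫ I(h'))` up to a bounded factor, times a
potential `exp (-(τ k - τ (k + 1)) y)` for the height `y ≥ 0` above the obstacle at time `k`.
Since `h'' < 0`, the coefficient `τ k - τ (k + 1)` is of order `1 / n`, so with `r = n ^ (1 / 3)`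
a walk at height `r` pays `r⁻²` per step, as much as for staying within a distance `r` of the
obstacle.

At this scale the profile `2 - e^{-x}` of the rescaled height `x = y / r` is a supersolution,
decaying by the factor `exp (-l r⁻²)` at every step: near the obstacle because it is concave, far
from it because of the potential. This gives the upper bound. For the lower bound, a bump is a
subsolution in a tube of width `r` around the height `R r`; the tube is reached, and left for the
prescribed endpoint, within `O(r)` steps, at a cost `exp (-O(r))`.
-/

noncomputable section

namespace ObstacleWalk

open scoped ENNReal Pointwise

section KilledWalk

variable {Ω : Type*} [MeasurableSpace Ω]

/-- One step of the walk with increment `ξ`, killed below the level `c`, as an operator on functions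
of the final position. -/
def killedStep (P : Measure Ω) (ξ : Ω → ℤ) (c : ℝ) (φ : ℤ → ℝ≥0∞) (z : ℤ) : ℝ≥0∞ :=
  ∫⁻ ω, {w : ℤ | c ≤ w}.indicator φ (z + ξ ω) ∂P

/-- The transition operator of the walk with increment `ξ` killed below the obstacle `c`:
`killedIter P ξ c k l` takes `l` steps starting at time `k`, so that the obstacle is tested at the
times `k + 1, …, k + l`. -/
def killedIter (P : Measure Ω) (ξ : Ω → ℤ) (c : ℕ → ℝ) : ℕ → ℕ → (ℤ → ℝ≥0∞) → ℤ → ℝ≥0∞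
  | _, 0, φ => φ
  | k, l + 1, φ => killedStep P ξ (c (k + 1)) (killedIter P ξ c (k + 1) l φ)

variable {P : Measure Ω} {ξ : Ω → ℤ} {c : ℕ → ℝ} {φ ψ : ℤ → ℝ≥0∞}

lemma killedStep_mono {c : ℝ} (h : ∀ z : ℤ, c ≤ z → φ z ≤ ψ z) (z : ℤ) :
    killedStep P ξ c φ z ≤ killedStep P ξ c ψ z :=
  lintegral_mono fun _ => Set.indicator_le_indicator' (h _)

lemma killedStep_const_mul (hξ : Measurable ξ) (c : ℝ) (a : ℝ≥0∞) (φ : ℤ → ℝ≥0∞) (z : ℤ) :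
    killedStep P ξ c (fun w => a * φ w) z = a * killedStep P ξ c φ z := by
  have hmeas : Measurable fun ω => {w : ℤ | c ≤ w}.indicator φ (z + ξ ω) :=
    Measurable.of_discrete.fun_comp (hξ.const_add z)
  rw [killedStep, killedStep, ← lintegral_const_mul a hmeas]
  exact lintegral_congr fun _ => Set.indicator_const_mul _ _ _ _

lemma measure_mul_le_killedStep (hξ : Measurable ξ) {c : ℝ} {z x : ℤ} (hx : c ≤ (z + x : ℤ)) :
    P {ω | ξ ω = x} * φ (z + x) ≤ killedStep P ξ c φ z := by
  have hatom : MeasurableSet {ω | ξ ω = x} := hξ (measurableSet_singleton x)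
  rw [mul_comm, ← lintegral_indicator_const hatom]
  refine lintegral_mono (Set.indicator_le fun ω hω => ?_)
  rw [show ξ ω = x from hω, Set.indicator_of_mem (by exact hx)]

lemma killedIter_mono (h : ∀ z, φ z ≤ ψ z) (k l : ℕ) (z : ℤ) :
    killedIter P ξ c k l φ z ≤ killedIter P ξ c k l ψ z := by
  induction l generalizing k z with
  | zero => exact h z
  | succ l ih => exact killedStep_mono (fun w _ => ih (k + 1) w) z

lemma killedIter_const_mul (hξ : Measurable ξ) (c : ℕ → ℝ) (k l : ℕ) (a : ℝ≥0∞)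
    (φ : ℤ → ℝ≥0∞) (z : ℤ) :
    killedIter P ξ c k l (fun w => a * φ w) z = a * killedIter P ξ c k l φ z := by
  induction l generalizing k z with
  | zero => rfl
  | succ l ih => rw [killedIter, funext (ih (k + 1)), killedStep_const_mul hξ, killedIter]

lemma killedIter_add (c : ℕ → ℝ) (k l m : ℕ) (φ : ℤ → ℝ≥0∞) :
    killedIter P ξ c k (l + m) φ = killedIter P ξ c k l (killedIter P ξ c (k + l) m φ) := by
  induction l generalizing k with
  | zero => simp only [killedIter, Nat.zero_add, Nat.add_zero]
  | succ l ih =>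
    rw [Nat.add_right_comm, killedIter, killedIter, ih, Nat.add_right_comm k, add_assoc]

lemma killedIter_le_of_supersolution {g : ℕ → ℤ → ℝ≥0∞} {m : ℕ}
    (hg : ∀ k < m, ∀ z : ℤ, c k ≤ z → killedStep P ξ (c (k + 1)) (g (k + 1)) z ≤ g k z)
    {k l : ℕ} (hkl : k + l = m) {z : ℤ} (hz : c k ≤ z) :
    killedIter P ξ c k l (g m) z ≤ g k z := by
  induction l generalizing k z with
  | zero => subst hkl; exact le_rfl
  | succ l ih =>
    exact (killedStep_mono (fun w hw => ih (by omega) hw) z).trans (hg k (by omega) z hz)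

lemma le_killedIter_of_subsolution {g : ℕ → ℤ → ℝ≥0∞} {m : ℕ} {k l : ℕ}
    (hg : ∀ i, k ≤ i → i < m → ∀ z : ℤ, g i z ≤ killedStep P ξ (c (i + 1)) (g (i + 1)) z)
    (hkl : k + l = m) (z : ℤ) :
    g k z ≤ killedIter P ξ c k l (g m) z := by
  induction l generalizing k z with
  | zero => subst hkl; exact le_rfl
  | succ l ih =>
    exact (hg k le_rfl (by omega) z).trans
      (killedStep_mono (fun w _ => ih (fun i hi => hg i (by omega)) (by omega) w) z)

lemma pow_mul_le_killedIter (hξ : Measurable ξ) {A : Set ℤ} {q : ℝ≥0∞} {d : ℝ}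
    (hA : ∀ y ∈ A, q ≤ P {ω | ξ ω = y} ∧ d ≤ y) {k l : ℕ} {z x : ℤ} (hx : x ∈ l • A)
    (hc : ∀ i, 1 ≤ i → i ≤ l → c (k + i) ≤ z + i * d) :
    q ^ l * φ (z + x) ≤ killedIter P ξ c k l φ z := by
  induction l generalizing k z x with
  | zero =>
    obtain rfl : x = 0 := by simpa only [zero_nsmul, Set.mem_zero] using hx
    rw [pow_zero, one_mul, add_zero]
    rfl
  | succ l ih =>
    rw [succ_nsmul'] at hx
    obtain ⟨y, hy, x, hxl, rfl⟩ := Set.mem_add.1 hx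
    have hfirst : c (k + 1) ≤ (z + y : ℤ) := by
      have := hc 1 le_rfl (by omega)
      push_cast at this ⊢
      linarith [(hA y hy).2]
    have hrest : q ^ l * φ (z + y + x) ≤ killedIter P ξ c (k + 1) l φ (z + y) :=
      ih hxl fun i hi hil => by
        have := hc (i + 1) (by omega) (by omega)
        rw [add_right_comm, add_assoc]
        push_cast at this ⊢
        linarith [(hA y hy).2]
    calc q ^ (l + 1) * φ (z + (y + x)) = q * (q ^ l * φ (z + y + x)) := by
          rw [pow_succ', mul_assoc, add_assoc]
      _ ≤ P {ω | ξ ω = y} * killedIter P ξ c (k + 1) l φ (z + y) := mul_le_mul' (hA y hy).1 hrest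
      _ ≤ killedIter P ξ c k (l + 1) φ z := measure_mul_le_killedStep hξ hfirst

end KilledWalk

section Markov

variable {Ω : Type*} [MeasurableSpace Ω] {P : Measure Ω} {X : ℕ → Ω → ℤ}

/-- The event that the walk with increments `X` is above the obstacle `c` at the times
`0, …, k`. -/
def staysAbove {Ω : Type*} (X : ℕ → Ω → ℤ) (c : ℕ → ℝ) (k : ℕ) : Set Ω :=
  {ω | ∀ i ≤ k, c i ≤ walk X i ω}

/-- The first `k` increments, continued by zeros, as a random element of `ℕ → ℤ`. It carries the
part of the increment sequence which is independent of `X k`. -/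
def past {Ω : Type*} (X : ℕ → Ω → ℤ) (k : ℕ) (ω : Ω) (j : ℕ) : ℤ :=
  if j < k then X j ω else 0

lemma measurable_walk (hX : ∀ i, Measurable (X i)) (k : ℕ) : Measurable (walk X k) :=
  Finset.measurable_fun_sum _ fun i _ => hX i

lemma measurableSet_staysAbove (hX : ∀ i, Measurable (X i)) (c : ℕ → ℝ) (k : ℕ) :
    MeasurableSet (staysAbove X c k) := by
  simp only [staysAbove, Set.ofPred_forall]
  exact MeasurableSet.iInter fun i => MeasurableSet.iInter fun _ =>
    measurable_walk hX i (MeasurableSet.of_discrete (s := {x : ℤ | c i ≤ x}))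

lemma walk_past {Ω : Type*} (X : ℕ → Ω → ℤ) {i k : ℕ} (hik : i ≤ k) (ω : Ω) :
    walk Function.eval i (past X k ω) = walk X i ω :=
  Finset.sum_congr rfl fun _ hj => if_pos ((Finset.mem_range.1 hj).trans_le hik)

lemma past_mem_staysAbove {Ω : Type*} (X : ℕ → Ω → ℤ) (c : ℕ → ℝ) (k : ℕ) (ω : Ω) :
    past X k ω ∈ staysAbove Function.eval c k ↔ ω ∈ staysAbove X c k :=
  forall₂_congr fun i hi => by rw [walk_past X hi]

lemma measurable_past (hX : ∀ i, Measurable (X i)) (k : ℕ) : Measurable (past X k) :=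
  measurable_pi_lambda _ fun j => by
    by_cases hj : j < k
    · simpa only [past, if_pos hj] using hX j
    · simpa only [past, if_neg hj] using measurable_const

lemma indepFun_past (hX : ∀ i, Measurable (X i)) (hindep : iIndepFun X P) (k : ℕ) :
    IndepFun (past X k) (X k) P := by
  let extend (u : Finset.range k → ℤ) (j : ℕ) : ℤ :=
    if hj : j < k then u ⟨j, Finset.mem_range.2 hj⟩ else 0
  have hextend : Measurable extend := measurable_pi_lambda _ fun j => by
    by_cases hj : j < k
    · simpa only [extend, dif_pos hj] using measurable_pi_apply _
    · simpa only [extend, dif_neg hj] using measurable_const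
  exact (hindep.indepFun_finset (Finset.range k) {k} (by simp) hX).comp hextend
    (measurable_pi_apply ⟨k, Finset.mem_singleton_self k⟩)

lemma lintegral_comp_prodMk_of_indepFun [IsFiniteMeasure P] {α β : Type*} [MeasurableSpace α]
    [MeasurableSpace β] {U : Ω → α} {V : Ω → β} (hU : Measurable U) (hV : Measurable V)
    (hUV : IndepFun U V P) {Φ : α × β → ℝ≥0∞} (hΦ : Measurable Φ) :
    ∫⁻ ω, Φ (U ω, V ω) ∂P = ∫⁻ ω, ∫⁻ ω', Φ (U ω, V ω') ∂P ∂P := by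
  calc ∫⁻ ω, Φ (U ω, V ω) ∂P = ∫⁻ p, Φ p ∂((P.map U).prod (P.map V)) := by
        rw [← (indepFun_iff_map_prod_eq_prod_map_map hU.aemeasurable hV.aemeasurable).1 hUV,
          lintegral_map hΦ (hU.prodMk hV)]
    _ = ∫⁻ ω, ∫⁻ y, Φ (U ω, y) ∂(P.map V) ∂P := by
        rw [lintegral_prod _ hΦ.aemeasurable, lintegral_map hΦ.lintegral_prod_right' hU]
    _ = ∫⁻ ω, ∫⁻ ω', Φ (U ω, V ω') ∂P ∂P :=
        lintegral_congr fun _ => lintegral_map (hΦ.comp measurable_prodMk_left) hV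

lemma indicator_staysAbove_succ {Ω : Type*} (X : ℕ → Ω → ℤ) (c : ℕ → ℝ) (k : ℕ)
    (φ : ℤ → ℝ≥0∞) (ω : Ω) :
    (staysAbove X c (k + 1)).indicator (fun ω => φ (walk X (k + 1) ω)) ω =
      (staysAbove X c k).indicator
        (fun ω => {w : ℤ | c (k + 1) ≤ w}.indicator φ (walk X k ω + X k ω)) ω := by
  classical
  have hwalk : walk X (k + 1) ω = walk X k ω + X k ω := Finset.sum_range_succ _ _
  have hmem : ω ∈ staysAbove X c (k + 1) ↔
      ω ∈ staysAbove X c k ∧ c (k + 1) ≤ (walk X k ω + X k ω : ℤ) := by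
    simp only [staysAbove, Set.mem_ofPred_eq, Nat.le_succ_iff_eq_or_le, forall_eq_or_imp, hwalk]
    exact and_comm
  simp only [Set.indicator_apply, hmem, Set.mem_ofPred_eq, hwalk, ← ite_and]

lemma lintegral_staysAbove_succ [IsFiniteMeasure P] (hX : ∀ i, Measurable (X i))
    (hindep : iIndepFun X P) (hident : ∀ i, IdentDistrib (X i) (X 0) P P) (c : ℕ → ℝ) (k : ℕ)
    (φ : ℤ → ℝ≥0∞) :
    ∫⁻ ω in staysAbove X c (k + 1), φ (walk X (k + 1) ω) ∂P =
      ∫⁻ ω in staysAbove X c k, killedStep P (X 0) (c (k + 1)) φ (walk X k ω) ∂P := by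
  let ψ : ℤ → ℝ≥0∞ := {w : ℤ | c (k + 1) ≤ w}.indicator φ
  let Φ : (ℕ → ℤ) × ℤ → ℝ≥0∞ := (Prod.fst ⁻¹' staysAbove Function.eval c k).indicator
    fun p => ψ (walk Function.eval k p.1 + p.2)
  have hΦ : Measurable Φ := by
    have hwalk := measurable_walk (X := Function.eval (β := fun _ : ℕ => ℤ)) measurable_pi_apply k
    refine Measurable.indicator ?_
      (measurable_fst (measurableSet_staysAbove measurable_pi_apply c k))
    exact (Measurable.of_discrete (f := ψ)).comp
      ((hwalk.comp measurable_fst).add measurable_snd)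
  have hΦ_past (ω : Ω) (x : ℤ) : Φ (past X k ω, x) =
      (staysAbove X c k).indicator (fun ω => ψ (walk X k ω + x)) ω := by
    classical
    simp only [Φ, Set.indicator_apply, Set.mem_preimage, past_mem_staysAbove, walk_past X le_rfl]
  rw [← lintegral_indicator (measurableSet_staysAbove hX c (k + 1)),
    ← lintegral_indicator (measurableSet_staysAbove hX c k)]
  calc ∫⁻ ω, (staysAbove X c (k + 1)).indicator (fun ω => φ (walk X (k + 1) ω)) ω ∂P
      = ∫⁻ ω, Φ (past X k ω, X k ω) ∂P := lintegral_congr fun ω => by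
        rw [indicator_staysAbove_succ, hΦ_past]; rfl
    _ = ∫⁻ ω, ∫⁻ ω', Φ (past X k ω, X k ω') ∂P ∂P :=
        lintegral_comp_prodMk_of_indepFun (measurable_past hX k) (hX k)
          (indepFun_past hX hindep k) hΦ
    _ = ∫⁻ ω, ∫⁻ ω', Φ (past X k ω, X 0 ω') ∂P ∂P := lintegral_congr fun ω =>
        ((hident k).comp (hΦ.comp measurable_prodMk_left)).lintegral_eq
    _ = _ := lintegral_congr fun ω => by
        by_cases hω : ω ∈ staysAbove X c k
        · simp only [hΦ_past, Set.indicator_of_mem hω]; rfl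
        · simp only [hΦ_past, Set.indicator_of_notMem hω, lintegral_zero]

lemma lintegral_staysAbove_eq_killedIter [IsProbabilityMeasure P] (hX : ∀ i, Measurable (X i))
    (hindep : iIndepFun X P) (hident : ∀ i, IdentDistrib (X i) (X 0) P P) {c : ℕ → ℝ}
    (hc : c 0 ≤ 0) (φ : ℤ → ℝ≥0∞) (n : ℕ) :
    ∫⁻ ω in staysAbove X c n, φ (walk X n ω) ∂P = killedIter P (X 0) c 0 n φ 0 := by
  have hsplit : ∀ l k, ∫⁻ ω in staysAbove X c (k + l), φ (walk X (k + l) ω) ∂P =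
      ∫⁻ ω in staysAbove X c k, killedIter P (X 0) c k l φ (walk X k ω) ∂P := by
    intro l
    induction l with
    | zero => exact fun k => rfl
    | succ l ih =>
      intro k
      rw [← add_assoc, add_right_comm, ih (k + 1), lintegral_staysAbove_succ hX hindep hident]
      rfl
  have hstart : staysAbove X c 0 = Set.univ := by
    ext ω; simp [staysAbove, walk, hc]
  simpa [hstart, walk] using hsplit n 0

lemma measure_aboveEvent [IsProbabilityMeasure P] (hX : ∀ i, Measurable (X i))
    (hindep : iIndepFun X P) (hident : ∀ i, IdentDistrib (X i) (X 0) P P) {h : ℝ → ℝ}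
    (h0 : h 0 = 0) (n : ℕ) :
    P (aboveEvent X h n) = killedIter P (X 0) (obstacle h n) 0 n
      (Set.indicator {⌈obstacle h n n⌉} 1) 0 := by
  have htarget : MeasurableSet (walk X n ⁻¹' {⌈obstacle h n n⌉}) :=
    measurable_walk hX n (measurableSet_singleton _)
  have hevent : aboveEvent X h n =
      walk X n ⁻¹' {⌈obstacle h n n⌉} ∩ staysAbove X (obstacle h n) n := Set.inter_comm _ _
  rw [← lintegral_staysAbove_eq_killedIter hX hindep hident (by simp [obstacle, h0]), hevent,
    ← Measure.restrict_apply htarget, ← lintegral_indicator_one htarget]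
  rfl

end Markov

section Reachability

open Filter Topology

variable {Ω : Type*} [MeasurableSpace Ω] {P : Measure Ω} {ξ : Ω → ℤ} {X : ℕ → Ω → ℤ}

/-- The possible values of an integer-valued random variable. The sites that a walk with increment
`ξ` can reach in exactly `l` steps are then `l • atoms P ξ`, in the sense of pointwise sums. -/
def atoms (P : Measure Ω) (ξ : Ω → ℤ) : Set ℤ :=
  {x | 0 < P {ω | ξ ω = x}}

lemma ae_mem_atoms : ∀ᵐ ω ∂P, ξ ω ∈ atoms P ξ := by
  have h : ∀ᵐ ω ∂P, ∀ x ∉ atoms P ξ, ξ ω ≠ x := by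
    refine ae_all_iff.2 fun x => ae_all_iff.2 fun hx => measure_eq_zero_iff_ae_notMem.1 ?_
    exact not_not.1 fun hpos => hx (pos_iff_ne_zero.2 hpos)
  filter_upwards [h] with ω hω
  exact not_not.1 fun hnot => hω _ hnot rfl

lemma mem_nsmul_atoms_of_measure_pos (hident : ∀ i, IdentDistrib (X i) (X 0) P P) {k : ℕ} {x : ℤ}
    (h : 0 < P {ω | walk X k ω = x}) : x ∈ k • atoms P (X 0) := by
  have hae : ∀ᵐ ω ∂P, ∀ i, X i ω ∈ atoms P (X 0) := ae_all_iff.2 fun i => by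
    filter_upwards [ae_mem_atoms (P := P) (ξ := X i)] with ω hω
    exact hω.trans_eq ((hident i).measure_mem_eq (measurableSet_singleton (X i ω)))
  obtain ⟨ω, rfl, hω⟩ := ((frequently_ae_iff.2 h.ne').and_eventually hae).exists
  have hsum := Set.finsetSum_mem_finsetSum (Finset.range k) (fun _ => atoms P (X 0))
    (fun i => X i ω) fun i _ => hω i
  rwa [Finset.sum_const, Finset.card_range] at hsum

lemma exists_common_nsmul_atoms (hident : ∀ i, IdentDistrib (X i) (X 0) P P)
    (hirr : IsIrreducibleWalk X P) (haper : IsAperiodicWalk X P) :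
    ∃ K : ℕ, {-1, 0, 1} ⊆ K • atoms P (X 0) := by
  let returnTimes : AddSubmonoid ℕ :=
    { carrier := {k | 0 ∈ k • atoms P (X 0)}
      zero_mem' := by simp
      add_mem' := fun {k l} hk hl => by
        have := Set.add_mem_add (s := k • atoms P (X 0)) (t := l • atoms P (X 0)) hk hl
        rwa [add_zero, ← add_nsmul] at this }
  have hgcd : Nat.setGcd returnTimes = 1 := haper _ fun k _ hk =>
    Nat.setGcd_dvd_of_mem (mem_nsmul_atoms_of_measure_pos hident hk)
  obtain ⟨N, hN⟩ := Nat.exists_mem_closure_of_ge (returnTimes : Set ℕ)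
  have hreturn : ∀ m ≥ N, (0 : ℤ) ∈ m • atoms P (X 0) := fun m hm => by
    have := hN m hm (by simp [hgcd])
    rwa [AddSubmonoid.closure_eq] at this
  have hpad : ∀ {k m : ℕ} {x : ℤ}, 0 < P {ω | walk X k ω = x} → N ≤ m →
      x ∈ (k + m) • atoms P (X 0) := fun {k m x} hk hm => by
    simpa only [add_nsmul, add_zero] using
      Set.add_mem_add (mem_nsmul_atoms_of_measure_pos hident hk) (hreturn m hm)
  obtain ⟨k, hk⟩ := hirr 1
  obtain ⟨l, hl⟩ := hirr (-1)
  refine ⟨k + (l + N), ?_⟩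
  rintro x (rfl | rfl | rfl)
  · rw [add_left_comm]
    exact hpad hl (by omega)
  · exact hreturn _ (by omega)
  · exact hpad hk (by omega)

lemma mem_nsmul_of_abs_le {G : ℕ} {D : ℤ} (hD : |D| ≤ G) : D ∈ G • ({-1, 0, 1} : Set ℤ) := by
  induction G generalizing D with
  | zero => simpa using hD
  | succ G ih =>
    rw [succ_nsmul, ← sub_add_cancel D D.sign]
    refine Set.add_mem_add (ih ?_) ?_
    · rw [Nat.cast_succ, abs_le] at hD
      rcases lt_trichotomy D 0 with h | rfl | h
      · rw [Int.sign_eq_neg_one_of_neg h, abs_le]; omega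
      · simp
      · rw [Int.sign_eq_one_of_pos h, abs_le]; omega
    · rcases Int.sign_trichotomy D with h | h | h <;> simp [h]

lemma exists_finite_subset_mem_nsmul {A : Set ℤ} {l : ℕ} {x : ℤ} (hx : x ∈ l • A) :
    ∃ B ⊆ A, B.Finite ∧ x ∈ l • B := by
  obtain ⟨f, hf⟩ := Set.mem_nsmul.1 hx
  refine ⟨Set.range fun i => (f i : ℤ), Set.range_subset_iff.2 fun i => (f i).2,
    Set.finite_range _, Set.mem_nsmul.2 ⟨fun i => ⟨f i, i, rfl⟩, hf⟩⟩

lemma exists_finite_blocks (hident : ∀ i, IdentDistrib (X i) (X 0) P P)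
    (hirr : IsIrreducibleWalk X P) (haper : IsAperiodicWalk X P) :
    ∃ (K : ℕ) (B : Set ℤ), B ⊆ atoms P (X 0) ∧ B.Finite ∧
      ∀ (G : ℕ) (D : ℤ), |D| ≤ G → D ∈ (G * K) • B := by
  obtain ⟨K, hK⟩ := exists_common_nsmul_atoms hident hirr haper
  simp only [Set.insert_subset_iff, Set.singleton_subset_iff] at hK
  obtain ⟨B₁, hB₁, hfin₁, h₁⟩ := exists_finite_subset_mem_nsmul hK.1
  obtain ⟨B₂, hB₂, hfin₂, h₂⟩ := exists_finite_subset_mem_nsmul hK.2.1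
  obtain ⟨B₃, hB₃, hfin₃, h₃⟩ := exists_finite_subset_mem_nsmul hK.2.2
  refine ⟨K, B₁ ∪ (B₂ ∪ B₃), Set.union_subset hB₁ (Set.union_subset hB₂ hB₃),
    hfin₁.union (hfin₂.union hfin₃), fun G D hD => ?_⟩
  have hblock : ({-1, 0, 1} : Set ℤ) ⊆ K • (B₁ ∪ (B₂ ∪ B₃)) := by
    simp only [Set.insert_subset_iff, Set.singleton_subset_iff]
    exact ⟨Set.nsmul_subset_nsmul_left (by grind) h₁, Set.nsmul_subset_nsmul_left (by grind) h₂,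
      Set.nsmul_subset_nsmul_left (by grind) h₃⟩
  rw [mul_nsmul']
  exact Set.nsmul_subset_nsmul_left hblock (mem_nsmul_of_abs_le hD)

lemma exists_uniform_blocks [IsFiniteMeasure P] (hident : ∀ i, IdentDistrib (X i) (X 0) P P)
    (hirr : IsIrreducibleWalk X P) (haper : IsAperiodicWalk X P) :
    ∃ (K : ℕ) (B : Set ℤ) (C q : ℝ), 0 ≤ C ∧ 0 < q ∧
      (∀ y ∈ B, ENNReal.ofReal q ≤ P {ω | X 0 ω = y} ∧ -C ≤ (y : ℝ)) ∧
      ∀ (G : ℕ) (D : ℤ), |D| ≤ G → D ∈ (G * K) • B := by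
  obtain ⟨K, B, hB, hfin, hreach⟩ := exists_finite_blocks hident hirr haper
  obtain ⟨d, hd⟩ := hfin.bddBelow
  have hsmall : ∀ᶠ q : ℝ in 𝓝[>] 0, ∀ y ∈ B, q ≤ P.real {ω | X 0 ω = y} :=
    (eventually_all_finite hfin).2 fun y hy => Filter.mem_of_superset
      (Ioc_mem_nhdsGT (ENNReal.toReal_pos (hB hy).ne' (measure_ne_top _ _))) fun q hq => hq.2
  obtain ⟨q, hq, hq0⟩ := (hsmall.and self_mem_nhdsWithin).exists
  refine ⟨K, B, |(d : ℝ)|, q, abs_nonneg _, hq0, fun y hy => ⟨?_, ?_⟩, hreach⟩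
  · exact ENNReal.ofReal_le_of_le_toReal (hq y hy)
  · exact (neg_abs_le _).trans (Int.cast_le.2 (hd hy))

end Reachability

section Profiles

lemma quadratic_sub_cube_le_exp (w : ℝ) : 1 + w + w ^ 2 / 2 - |w| ^ 3 ≤ Real.exp w := by
  rcases le_total 0 w with hw | hw
  · linarith [Real.quadratic_le_exp_of_nonneg hw, pow_nonneg (abs_nonneg w) 3]
  rcases le_total |w| 1 with h1 | h1
  · have h := Real.exp_bound h1 (n := 3) (by norm_num)
    simp only [Finset.sum_range_succ, Finset.sum_range_zero, Nat.factorial] at h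
    norm_num at h
    nlinarith [(abs_le.1 h).1, pow_nonneg (abs_nonneg w) 3]
  · rw [abs_of_nonpos hw] at h1 ⊢
    nlinarith [mul_nonneg (sub_nonneg.2 h1) (sq_nonneg w), sq_nonneg (w + 1), Real.exp_pos w]

/-- The increasing concave profile `2 - e^{-x}`, killed below `0`; it serves as a supersolution for
the walk above the obstacle. -/
def satProfile (x : ℝ) : ℝ := if 0 ≤ x then 2 - Real.exp (-x) else 0

lemma satProfile_of_nonneg {x : ℝ} (hx : 0 ≤ x) : satProfile x = 2 - Real.exp (-x) := if_pos hx

lemma satProfile_of_neg {x : ℝ} (hx : x < 0) : satProfile x = 0 := if_neg hx.not_ge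

lemma one_le_satProfile {x : ℝ} (hx : 0 ≤ x) : 1 ≤ satProfile x := by
  rw [satProfile_of_nonneg hx]
  linarith [Real.exp_le_one_iff.2 (neg_nonpos.2 hx)]

lemma satProfile_le_two (x : ℝ) : satProfile x ≤ 2 := by
  unfold satProfile
  split_ifs
  · linarith [Real.exp_pos (-x)]
  · norm_num

lemma satProfile_nonneg (x : ℝ) : 0 ≤ satProfile x := by
  rcases le_or_gt 0 x with hx | hx
  · linarith [one_le_satProfile hx]
  · rw [satProfile_of_neg hx]

lemma measurable_satProfile : Measurable satProfile :=
  Measurable.ite measurableSet_Ici (by fun_prop) measurable_const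

lemma satProfile_add_le {x : ℝ} (hx : 0 ≤ x) (u : ℝ) :
    satProfile (x + u) ≤ 2 - Real.exp (-x) * (1 - u + u ^ 2 / 2) + 10 * |u| ^ 3 := by
  have he0 := Real.exp_pos (-x)
  have he1 : Real.exp (-x) ≤ 1 := Real.exp_le_one_iff.2 (by linarith)
  have hu3 : 0 ≤ |u| ^ 3 := by positivity
  rcases le_or_gt 0 (x + u) with h | h
  · rw [satProfile_of_nonneg h, neg_add, Real.exp_add]
    have h1 := quadratic_sub_cube_le_exp (-u)
    rw [abs_neg] at h1
    nlinarith [mul_le_mul_of_nonneg_left h1 he0.le, mul_nonneg hu3 (sub_nonneg.2 he1)]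
  · have hu : u < 0 := by linarith
    rw [satProfile_of_neg h, abs_of_neg hu]
    have h2 : Real.exp (-x) * (1 - u + u ^ 2 / 2) ≤ 1 * (1 - u + u ^ 2 / 2) :=
      mul_le_mul_of_nonneg_right he1 (by nlinarith)
    have h3 : 1 - u + u ^ 2 / 2 ≤ 2 + 10 * (-u) ^ 3 := by
      rcases le_total (-u) (1 / 2) with h4 | h4
      · nlinarith [pow_nonneg (neg_nonneg.2 hu.le) 3]
      · nlinarith [mul_nonneg (sub_nonneg.2 h4) (sq_nonneg u)]
    linarith

/-- The `C^{1,1}` bump `((1 - w²)⁺)²`; it serves as a subsolution for the walk in a tube. -/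
def bump (w : ℝ) : ℝ := max (1 - w ^ 2) 0 ^ 2

lemma bump_nonneg (w : ℝ) : 0 ≤ bump w := by unfold bump; positivity

lemma bump_of_abs_le {w : ℝ} (hw : |w| ≤ 1) : bump w = (1 - w ^ 2) ^ 2 := by
  rw [bump, max_eq_left (sub_nonneg.2 ((sq_le_one_iff_abs_le_one w).2 hw))]

lemma bump_of_one_le_abs {w : ℝ} (hw : 1 ≤ |w|) : bump w = 0 := by
  rw [bump, max_eq_right (sub_nonpos.2 ((one_le_sq_iff_one_le_abs w).2 hw)), zero_pow two_ne_zero]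

lemma bump_le_one (w : ℝ) : bump w ≤ 1 :=
  pow_le_one₀ (le_max_right _ _) (max_le (by linarith [sq_nonneg w]) zero_le_one)

lemma measurable_bump : Measurable bump := by unfold bump; fun_prop

lemma bump_neg (w : ℝ) : bump (-w) = bump w := by simp only [bump, neg_sq]

lemma le_bump_of_abs_le {w : ℝ} (hw : |w| ≤ 3 / 4) : 1 / 6 ≤ bump w := by
  rw [bump_of_abs_le (by linarith)]
  nlinarith [sq_le_sq' (by linarith [(abs_le.1 hw).1]) (abs_le.1 hw).2]

lemma le_bump_add {w : ℝ} (hw : |w| ≤ 1) (u : ℝ) :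
    bump w - 4 * w * (1 - w ^ 2) * u - 2 * u ^ 2 ≤ bump (w + u) := by
  have hp : 0 ≤ 1 - w ^ 2 := sub_nonneg.2 ((sq_le_one_iff_abs_le_one w).2 hw)
  rw [bump_of_abs_le hw, bump]
  -- the square is convex: it lies above its tangent at `1 - w ^ 2`
  nlinarith [sq_nonneg (max (1 - (w + u) ^ 2) 0 - (1 - w ^ 2)),
    mul_nonneg hp (sub_nonneg.2 (le_max_left (1 - (w + u) ^ 2) 0)),
    mul_nonneg (sq_nonneg w) (sq_nonneg u)]

lemma le_bump_add_of_nonneg {w u : ℝ} (hw : -1 ≤ w) (hw' : w ≤ -3 / 4) (hu : 0 ≤ u) :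
    bump w - 4 * w * (1 - w ^ 2) * u + u ^ 2 - 6 * u ^ 3 ≤ bump (w + u) := by
  have hp : 0 ≤ 1 - w ^ 2 := by nlinarith
  rw [bump_of_abs_le (abs_le.2 ⟨hw, by linarith⟩)]
  rcases le_total (w + u) 1 with h | h
  · rw [bump_of_abs_le (abs_le.2 ⟨by linarith, h⟩)]
    nlinarith [mul_nonneg (sq_nonneg u) (show 0 ≤ 6 * w ^ 2 - 2 - 1 by nlinarith),
      mul_nonneg (pow_nonneg hu 3) (show 0 ≤ w + 1 by linarith), pow_nonneg hu 3, pow_nonneg hu 4]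
  · have hu1 : 1 ≤ u := by linarith
    have h2 : u ≤ u ^ 2 := by nlinarith
    have h3 : u ^ 2 ≤ u ^ 3 := pow_le_pow_right₀ hu1 (by norm_num)
    have hp2 : (1 - w ^ 2) ^ 2 ≤ 1 := by nlinarith
    have hwp : -w * (1 - w ^ 2) ≤ 1 := by nlinarith
    nlinarith [hp2, bump_nonneg (w + u)]

lemma le_bump_add_of_nonpos {w u : ℝ} (hw : -1 ≤ w) (hw' : w ≤ -3 / 4) (hu : u ≤ 0) :
    bump w - 4 * w * (1 - w ^ 2) * u - 6 * (-u) ^ 3 ≤ bump (w + u) := by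
  have hp : 0 ≤ 1 - w ^ 2 := by nlinarith
  have hu3 : 0 ≤ (-u) ^ 3 := pow_nonneg (neg_nonneg.2 hu) 3
  rw [bump_of_abs_le (abs_le.2 ⟨hw, by linarith⟩)]
  rcases le_total (-1) (w + u) with h | h
  · rw [bump_of_abs_le (abs_le.2 ⟨h, by linarith⟩)]
    nlinarith [mul_nonneg (sq_nonneg u) (show 0 ≤ 6 * w ^ 2 - 2 by nlinarith),
      mul_nonneg hu3 (show 0 ≤ -w by linarith), sq_nonneg (u ^ 2)]
  · have : (1 - w ^ 2) - 4 * w * u ≤ 0 := by nlinarith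
    nlinarith [bump_nonneg (w + u)]

end Profiles

section OneStep

variable {Ω : Type*} [MeasurableSpace Ω]

lemma max_zero_sq_le_sq (z : ℝ) : max z 0 ^ 2 ≤ z ^ 2 := by
  rw [← sq_abs z]
  exact pow_le_pow_left₀ (le_max_right _ _) (max_le (le_abs_self z) (abs_nonneg z)) 2

/-- Centred increments with third moment at most `M` whose positive and negative parts both have
second moment at least `v`. -/
structure Centred (Q : Measure Ω) (Z : Ω → ℝ) (v M : ℝ) : Prop where
  memLp : MemLp Z 3 Q
  mean : ∫ ω, Z ω ∂Q = 0
  third : ∫ ω, |Z ω| ^ 3 ∂Q ≤ M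
  pos : v ≤ ∫ ω, max (Z ω) 0 ^ 2 ∂Q
  neg : v ≤ ∫ ω, max (-Z ω) 0 ^ 2 ∂Q

namespace Centred

variable {Q : Measure Ω} {Z : Ω → ℝ} {v M : ℝ}

lemma nonneg (h : Centred Q Z v M) : 0 ≤ M :=
  (integral_nonneg fun ω => by positivity).trans h.third

lemma neg_centred (h : Centred Q Z v M) : Centred Q (fun ω => -Z ω) v M where
  memLp := h.memLp.neg
  mean := by rw [integral_neg, h.mean, neg_zero]
  third := by simpa only [abs_neg] using h.third
  pos := h.neg
  neg := by simpa only [neg_neg] using h.pos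

lemma integrable_cube (h : Centred Q Z v M) : Integrable (fun ω => |Z ω| ^ 3) Q := by
  simpa using h.memLp.integrable_norm_pow (p := 3) (by norm_num)

section Finite

variable [IsFiniteMeasure Q]

lemma integrable (h : Centred Q Z v M) : Integrable Z Q :=
  h.memLp.integrable (by norm_num)

lemma integrable_sq (h : Centred Q Z v M) : Integrable (fun ω => Z ω ^ 2) Q :=
  (h.memLp.mono_exponent (by norm_num)).integrable_sq

lemma integrable_pos_sq (h : Centred Q Z v M) : Integrable (fun ω => max (Z ω) 0 ^ 2) Q := by
  refine h.integrable_sq.mono' ?_ (Filter.Eventually.of_forall fun ω => ?_)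
  · have := h.memLp.aestronglyMeasurable.aemeasurable
    exact AEMeasurable.aestronglyMeasurable (by fun_prop)
  · rw [Real.norm_of_nonneg (by positivity)]
    exact max_zero_sq_le_sq _

lemma le_integral_sq (h : Centred Q Z v M) : v ≤ ∫ ω, Z ω ^ 2 ∂Q :=
  h.pos.trans (integral_mono h.integrable_pos_sq h.integrable_sq fun _ => max_zero_sq_le_sq _)

lemma integrable_taylor (h : Centred Q Z v M) {W : Ω → ℝ}
    (hW : Integrable W Q) (α β γ δ : ℝ) :
    Integrable (fun ω => α + β * Z ω + γ * W ω + δ * |Z ω| ^ 3) Q :=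
  (((integrable_const α).add (h.integrable.const_mul β)).add (hW.const_mul γ)).add
    (h.integrable_cube.const_mul δ)

lemma integrable_comp_affine (h : Centred Q Z v M) {G : ℝ → ℝ} (hG : Measurable G) {C : ℝ}
    (hG0 : ∀ y, 0 ≤ G y) (hGC : ∀ y, G y ≤ C) (x ε : ℝ) :
    Integrable (fun ω => G (x + ε * Z ω)) Q := by
  have := h.memLp.aestronglyMeasurable.aemeasurable
  refine Integrable.of_bound (C := C) ?_ (Filter.Eventually.of_forall fun ω => ?_)
  · exact (hG.comp_aemeasurable (by fun_prop)).aestronglyMeasurable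
  · rw [Real.norm_of_nonneg (hG0 _)]
    exact hGC _

lemma integrable_satProfile (h : Centred Q Z v M) (x ε : ℝ) :
    Integrable (fun ω => satProfile (x + ε * Z ω)) Q :=
  h.integrable_comp_affine measurable_satProfile satProfile_nonneg satProfile_le_two x ε

lemma integrable_bump (h : Centred Q Z v M) (w ε : ℝ) :
    Integrable (fun ω => bump (w + ε * Z ω)) Q :=
  h.integrable_comp_affine measurable_bump bump_nonneg bump_le_one w ε

end Finite

variable [IsProbabilityMeasure Q]

lemma integral_sq_le (h : Centred Q Z v M) : ∫ ω, Z ω ^ 2 ∂Q ≤ 1 + M := by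
  have hle (z : ℝ) : z ^ 2 ≤ 1 + |z| ^ 3 := by
    rw [← sq_abs z]
    nlinarith [sq_nonneg (|z| - 1), abs_nonneg z, mul_nonneg (abs_nonneg z) (sq_nonneg (|z| - 1))]
  calc ∫ ω, Z ω ^ 2 ∂Q ≤ ∫ ω, (1 + |Z ω| ^ 3) ∂Q :=
        integral_mono h.integrable_sq ((integrable_const 1).add h.integrable_cube)
          fun ω => hle (Z ω)
    _ = 1 + ∫ ω, |Z ω| ^ 3 ∂Q := by
        rw [integral_add (integrable_const 1) h.integrable_cube]
        simp
    _ ≤ 1 + M := by gcongr; exact h.third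

lemma integral_taylor (h : Centred Q Z v M) {W : Ω → ℝ} (hW : Integrable W Q)
    (α β γ δ : ℝ) :
    ∫ ω, (α + β * Z ω + γ * W ω + δ * |Z ω| ^ 3) ∂Q =
      α + γ * ∫ ω, W ω ∂Q + δ * ∫ ω, |Z ω| ^ 3 ∂Q := by
  have hαβ := (integrable_const α).add (h.integrable.const_mul β)
  have hαβγ := hαβ.add (hW.const_mul γ)
  simp only [Pi.add_def] at hαβ hαβγ
  rw [integral_add hαβγ (h.integrable_cube.const_mul δ), integral_add hαβ (hW.const_mul γ),
    integral_add (integrable_const α) (h.integrable.const_mul β), integral_const_mul,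
    integral_const_mul, integral_const_mul, h.mean]
  simp

lemma integral_satProfile_le (h : Centred Q Z v M) {ε x : ℝ} (hε : 0 ≤ ε) (hx : 0 ≤ x) :
    ∫ ω, satProfile (x + ε * Z ω) ∂Q ≤
      2 - Real.exp (-x) - Real.exp (-x) * (ε ^ 2 * v / 2) + 10 * ε ^ 3 * M := by
  set e := Real.exp (-x)
  calc ∫ ω, satProfile (x + ε * Z ω) ∂Q
      ≤ ∫ ω, (2 - e + e * ε * Z ω + -(e * ε ^ 2 / 2) * Z ω ^ 2 + 10 * ε ^ 3 * |Z ω| ^ 3) ∂Q := by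
        refine integral_mono (h.integrable_satProfile x ε)
          (h.integrable_taylor h.integrable_sq _ _ _ _) fun ω => ?_
        refine (satProfile_add_le hx (ε * Z ω)).trans_eq ?_
        rw [abs_mul, abs_of_nonneg hε]
        ring
    _ = 2 - e + -(e * ε ^ 2 / 2) * ∫ ω, Z ω ^ 2 ∂Q + 10 * ε ^ 3 * ∫ ω, |Z ω| ^ 3 ∂Q :=
        h.integral_taylor h.integrable_sq _ _ _ _
    _ ≤ _ := by
        have h2 := mul_le_mul_of_nonneg_left h.le_integral_sq (show 0 ≤ e * ε ^ 2 / 2 by positivity)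
        have h3 := mul_le_mul_of_nonneg_left h.third (show 0 ≤ 10 * ε ^ 3 by positivity)
        linarith

/-- Far from the obstacle the potential wins. -/
lemma exp_mul_integral_satProfile_le_of_one_le (h : Centred Q Z v M) {c l ε x : ℝ} (hv : 0 ≤ v)
    (hl : 0 ≤ l) (hlc : 2 * l ≤ c) (hε : 0 ≤ ε) (hεl : 10 * M * ε ≤ l) (hx : 1 ≤ x) :
    Real.exp (-(c * ε ^ 2 * x)) * ∫ ω, satProfile (x + ε * Z ω) ∂Q ≤
      Real.exp (-(l * ε ^ 2)) * satProfile x := by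
  have hI : ∫ ω, satProfile (x + ε * Z ω) ∂Q ≤ Real.exp (l * ε ^ 2) * satProfile x := by
    have hS := one_le_satProfile (zero_le_one.trans hx)
    have hb := h.integral_satProfile_le hε (zero_le_one.trans hx)
    rw [satProfile_of_nonneg (zero_le_one.trans hx)] at hS ⊢
    have : 0 ≤ Real.exp (-x) * (ε ^ 2 * v / 2) := by positivity
    nlinarith [Real.add_one_le_exp (l * ε ^ 2), mul_le_mul_of_nonneg_right hεl (sq_nonneg ε),
      mul_nonneg hl (sq_nonneg ε)]
  have hpot : Real.exp (-(c * ε ^ 2 * x)) ≤ Real.exp (-(2 * l * ε ^ 2)) := by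
    refine Real.exp_le_exp.2 (neg_le_neg ?_)
    nlinarith [mul_nonneg (sq_nonneg ε) (show 0 ≤ c * x - 2 * l by nlinarith)]
  calc _ ≤ Real.exp (-(2 * l * ε ^ 2)) * (Real.exp (l * ε ^ 2) * satProfile x) :=
        mul_le_mul hpot hI (integral_nonneg fun ω => satProfile_nonneg _) (Real.exp_pos _).le
    _ = Real.exp (-(l * ε ^ 2)) * satProfile x := by
        rw [← mul_assoc, ← Real.exp_add]
        ring_nf

/-- Close to the obstacle the concavity of the profile wins. -/
lemma integral_satProfile_le_of_le_one (h : Centred Q Z v M) {l ε x : ℝ} (hl : 0 ≤ l)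
    (hlv : 24 * l ≤ v) (hε : 0 ≤ ε) (hεl : 10 * M * ε ≤ l) (hx0 : 0 ≤ x) (hx : x ≤ 1) :
    ∫ ω, satProfile (x + ε * Z ω) ∂Q ≤ Real.exp (-(l * ε ^ 2)) * satProfile x := by
  have he : 1 / 3 ≤ Real.exp (-x) := by
    calc (1 / 3 : ℝ) ≤ (Real.exp 1)⁻¹ := by
          rw [one_div]
          exact inv_anti₀ (Real.exp_pos 1) Real.exp_one_lt_three.le
      _ ≤ Real.exp (-x) := by
          rw [← Real.exp_neg]
          exact Real.exp_le_exp.2 (neg_le_neg hx)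
  have hgain : ε ^ 2 * (4 * l) ≤ Real.exp (-x) * (ε ^ 2 * v / 2) := by
    have : 12 * l * ε ^ 2 ≤ ε ^ 2 * v / 2 := by nlinarith [sq_nonneg ε]
    nlinarith [mul_nonneg hl (sq_nonneg ε)]
  have hS := one_le_satProfile hx0
  have hb := h.integral_satProfile_le hε hx0
  calc ∫ ω, satProfile (x + ε * Z ω) ∂Q ≤ (1 - l * ε ^ 2) * satProfile x := by
        have hS2 := satProfile_le_two x
        rw [satProfile_of_nonneg hx0] at hS hS2 ⊢
        nlinarith [mul_le_mul_of_nonneg_right hεl (sq_nonneg ε), mul_nonneg hl (sq_nonneg ε)]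
    _ ≤ Real.exp (-(l * ε ^ 2)) * satProfile x :=
        mul_le_mul_of_nonneg_right (by linarith [Real.add_one_le_exp (-(l * ε ^ 2))])
          (satProfile_nonneg x)

lemma exp_mul_integral_satProfile_le (h : Centred Q Z v M) {c l ε x : ℝ} (hl : 0 ≤ l)
    (hlc : 2 * l ≤ c) (hlv : 24 * l ≤ v) (hε : 0 ≤ ε) (hεl : 10 * M * ε ≤ l) (hx : 0 ≤ x) :
    Real.exp (-(c * ε ^ 2 * x)) * ∫ ω, satProfile (x + ε * Z ω) ∂Q ≤
      Real.exp (-(l * ε ^ 2)) * satProfile x := by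
  rcases le_total 1 x with h1 | h1
  · exact h.exp_mul_integral_satProfile_le_of_one_le (by linarith) hl hlc hε hεl h1
  · have hpot : 0 ≤ c * ε ^ 2 * x := by
      have : 0 ≤ c := by linarith
      positivity
    exact (mul_le_of_le_one_left (integral_nonneg fun ω => satProfile_nonneg _)
      (Real.exp_le_one_iff.2 (neg_nonpos.2 hpot))).trans
      (h.integral_satProfile_le_of_le_one hl hlv hε hεl hx h1)

lemma bump_le_integral_bump_of_le (h : Centred Q Z v M) {ε w : ℝ} (hε : 0 ≤ ε)
    (hεv : 6 * M * ε ≤ v) (hw : -1 ≤ w) (hw' : w ≤ -3 / 4) :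
    bump w ≤ ∫ ω, bump (w + ε * Z ω) ∂Q := by
  calc bump w ≤ bump w + ε ^ 2 * ∫ ω, max (Z ω) 0 ^ 2 ∂Q
          + -(6 * ε ^ 3) * ∫ ω, |Z ω| ^ 3 ∂Q := by
        have hpos := mul_le_mul_of_nonneg_left h.pos (sq_nonneg ε)
        have hthird := mul_le_mul_of_nonneg_left h.third (show 0 ≤ 6 * ε ^ 3 by positivity)
        nlinarith [mul_le_mul_of_nonneg_right hεv (sq_nonneg ε)]
    _ = ∫ ω, (bump w + -(4 * w * (1 - w ^ 2) * ε) * Z ω + ε ^ 2 * max (Z ω) 0 ^ 2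
          + -(6 * ε ^ 3) * |Z ω| ^ 3) ∂Q := (h.integral_taylor h.integrable_pos_sq _ _ _ _).symm
    _ ≤ ∫ ω, bump (w + ε * Z ω) ∂Q := by
        refine integral_mono (h.integrable_taylor h.integrable_pos_sq _ _ _ _)
          (h.integrable_bump w ε) fun ω => ?_
        dsimp only
        rcases le_total 0 (Z ω) with hz | hz
        · refine le_trans (le_of_eq ?_) (le_bump_add_of_nonneg hw hw' (mul_nonneg hε hz))
          rw [max_eq_left hz, abs_of_nonneg hz]
          ring
        · refine le_trans (le_of_eq ?_)
            (le_bump_add_of_nonpos hw hw' (mul_nonpos_of_nonneg_of_nonpos hε hz))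
          rw [max_eq_right hz, abs_of_nonpos hz]
          ring

lemma exp_mul_bump_le_of_abs_le (h : Centred Q Z v M) {ε w : ℝ}
    (hεM : 24 * (1 + M) * ε ^ 2 ≤ 1) (hw : |w| ≤ 3 / 4) :
    Real.exp (-(24 * (1 + M) * ε ^ 2)) * bump w ≤ ∫ ω, bump (w + ε * Z ω) ∂Q := by
  have hM := h.nonneg
  have hs : 0 ≤ 24 * (1 + M) * ε ^ 2 := by positivity
  have hexp : Real.exp (-(24 * (1 + M) * ε ^ 2)) ≤ 1 - 24 * (1 + M) * ε ^ 2 / 2 := by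
    rw [Real.exp_neg, inv_le_iff_one_le_mul₀ (Real.exp_pos _)]
    nlinarith [Real.add_one_le_exp (24 * (1 + M) * ε ^ 2)]
  calc Real.exp (-(24 * (1 + M) * ε ^ 2)) * bump w ≤ bump w - 2 * ε ^ 2 * (1 + M) := by
        nlinarith [mul_le_mul_of_nonneg_right hexp (bump_nonneg w), le_bump_of_abs_le hw]
    _ ≤ bump w + -(2 * ε ^ 2) * ∫ ω, Z ω ^ 2 ∂Q + 0 * ∫ ω, |Z ω| ^ 3 ∂Q := by
        linarith [mul_le_mul_of_nonneg_left h.integral_sq_le (show 0 ≤ 2 * ε ^ 2 by positivity)]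
    _ = ∫ ω, (bump w + -(4 * w * (1 - w ^ 2) * ε) * Z ω + -(2 * ε ^ 2) * Z ω ^ 2
          + 0 * |Z ω| ^ 3) ∂Q := (h.integral_taylor h.integrable_sq _ _ _ _).symm
    _ ≤ ∫ ω, bump (w + ε * Z ω) ∂Q := by
        refine integral_mono (h.integrable_taylor h.integrable_sq _ _ _ _)
          (h.integrable_bump w ε) fun ω => ?_
        refine le_trans (le_of_eq ?_) (le_bump_add (by linarith) (ε * Z ω))
        ring

lemma exp_mul_bump_le (h : Centred Q Z v M) {ε : ℝ} (hε : 0 ≤ ε) (hεv : 6 * M * ε ≤ v)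
    (hεM : 24 * (1 + M) * ε ^ 2 ≤ 1) (w : ℝ) :
    Real.exp (-(24 * (1 + M) * ε ^ 2)) * bump w ≤ ∫ ω, bump (w + ε * Z ω) ∂Q := by
  rcases le_or_gt |w| (3 / 4) with hmid | hedge
  · exact h.exp_mul_bump_le_of_abs_le hεM hmid
  rcases le_or_gt 1 |w| with hout | hin
  · rw [bump_of_one_le_abs hout, mul_zero]
    exact integral_nonneg fun ω => bump_nonneg _
  have hM := h.nonneg
  have hs : 0 ≤ 24 * (1 + M) * ε ^ 2 := by positivity
  refine (mul_le_of_le_one_left (bump_nonneg w) (Real.exp_le_one_iff.2 (neg_nonpos.2 hs))).trans ?_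
  obtain ⟨hw1, hw2⟩ := abs_lt.1 hin
  rcases lt_abs.1 hedge with hright | hleft
  · have hsymm (ω : Ω) : bump (-w + ε * -Z ω) = bump (w + ε * Z ω) := by
      rw [← bump_neg]
      ring_nf
    simpa only [bump_neg, hsymm] using
      h.neg_centred.bump_le_integral_bump_of_le hε hεv (w := -w) (by linarith) (by linarith)
  · exact h.bump_le_integral_bump_of_le hε hεv hw1.le (by linarith)

end Centred

end OneStep

section MeanValue

lemma exists_bilipschitz_of_deriv_pos {f f' : ℝ → ℝ} {a b : ℝ} (hab : a ≤ b)
    (hf : ContinuousOn f (Set.Icc a b)) (hf' : ∀ x ∈ Set.Ioo a b, HasDerivAt f (f' x) x)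
    (hc : ContinuousOn f' (Set.Icc a b)) (hpos : ∀ x ∈ Set.Icc a b, 0 < f' x) :
    ∃ κ κ' : ℝ, 0 < κ ∧ 0 < κ' ∧ ∀ s ∈ Set.Icc a b, ∀ t ∈ Set.Icc a b, s ≤ t →
      κ * (t - s) ≤ f t - f s ∧ f t - f s ≤ κ' * (t - s) := by
  obtain ⟨x, hx, hmin⟩ := isCompact_Icc.exists_isMinOn (Set.nonempty_Icc.2 hab) hc
  obtain ⟨y, hy, hmax⟩ := isCompact_Icc.exists_isMaxOn (Set.nonempty_Icc.2 hab) hc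
  refine ⟨f' x, f' y, hpos x hx, hpos y hy, fun s hs t ht hst => ?_⟩
  rcases hst.eq_or_lt with rfl | hst
  · simp only [sub_self, mul_zero, le_refl, and_self]
  have hsub : Set.Icc s t ⊆ Set.Icc a b := Set.Icc_subset_Icc hs.1 ht.2
  obtain ⟨u, hu, hslope⟩ := exists_hasDerivAt_eq_slope f f' hst (hf.mono hsub)
    fun u hu => hf' u (Set.Ioo_subset_Ioo hs.1 ht.2 hu)
  have huI := hsub (Set.Ioo_subset_Icc_self hu)
  have hts : 0 < t - s := sub_pos.2 hst
  rw [← div_mul_cancel₀ (f t - f s) hts.ne', ← hslope]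
  exact ⟨mul_le_mul_of_nonneg_right (hmin huI) hts.le, mul_le_mul_of_nonneg_right (hmax huI) hts.le⟩

end MeanValue

section Tilt

variable {Ω : Type*} [MeasurableSpace Ω] {P : Measure Ω} {Y : Ω → ℝ} {ξ : Ω → ℤ} {a b t x : ℝ}

lemma mem_interior_integrableExpSet_iff : t ∈ interior (integrableExpSet Y P) ↔
    lowerTilt Y P < (t : EReal) ∧ (t : EReal) < upperTilt Y P := by
  constructor
  · intro ht
    obtain ⟨u, w, ⟨hut, htw⟩, hsub⟩ :=
      mem_nhds_iff_exists_Ioo_subset.1 (mem_interior_iff_mem_nhds.1 ht)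
    obtain ⟨u', huu', hu't⟩ := exists_between hut
    obtain ⟨w', htw', hw'w⟩ := exists_between htw
    exact ⟨sInf_lt_iff.2 ⟨u', ⟨u', hsub ⟨huu', hu't.trans htw⟩, rfl⟩, EReal.coe_lt_coe_iff.2 hu't⟩,
      lt_sSup_iff.2 ⟨w', ⟨w', hsub ⟨hut.trans htw', hw'w⟩, rfl⟩, EReal.coe_lt_coe_iff.2 htw'⟩⟩
  · rintro ⟨hlow, hupp⟩
    obtain ⟨_, ⟨u, hu, rfl⟩, hut⟩ := sInf_lt_iff.1 hlow
    obtain ⟨_, ⟨w, hw, rfl⟩, htw⟩ := lt_sSup_iff.1 hupp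
    refine mem_interior.2 ⟨Set.Ioo u w, fun s hs => ?_, isOpen_Ioo,
      EReal.coe_lt_coe_iff.1 hut, EReal.coe_lt_coe_iff.1 htw⟩
    exact convex_integrableExpSet.ordConnected.out hu hw ⟨hs.1.le, hs.2.le⟩

lemma Icc_subset_interior_integrableExpSet (ha : lowerTilt Y P < (a : EReal))
    (hb : (b : EReal) < upperTilt Y P) : Set.Icc a b ⊆ interior (integrableExpSet Y P) :=
  fun _ ht => mem_interior_integrableExpSet_iff.2
    ⟨ha.trans_le (EReal.coe_le_coe_iff.2 ht.1), (EReal.coe_le_coe_iff.2 ht.2).trans_lt hb⟩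

lemma deriv_deriv_cgf (ht : t ∈ interior (integrableExpSet Y P)) :
    deriv (deriv (cgf Y P)) t = variance Y (P.tilted (t * Y ·)) := by
  rw [variance_tilted_mul ht, iteratedDeriv_succ, iteratedDeriv_one]

lemma convexOn_cgf : ConvexOn ℝ (interior (integrableExpSet Y P)) (cgf Y P) := by
  refine convexOn_of_deriv2_nonneg' convex_integrableExpSet.interior
    (fun t ht => (analyticAt_cgf ht).differentiableAt.differentiableWithinAt)
    (fun t ht => (analyticAt_cgf ht).deriv.differentiableAt.differentiableWithinAt) fun t ht => ?_
  rw [Function.iterate_succ_apply, Function.iterate_one, deriv_deriv_cgf ht]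
  exact variance_nonneg _ _

lemma monotoneOn_deriv_cgf :
    MonotoneOn (deriv (cgf Y P)) (interior (integrableExpSet Y P)) :=
  convexOn_cgf.monotoneOn_deriv fun _ ht => (analyticAt_cgf ht).differentiableAt

lemma cgf_add_deriv_mul_le {t' : ℝ} (ht : t ∈ interior (integrableExpSet Y P))
    (ht' : t' ∈ interior (integrableExpSet Y P)) :
    cgf Y P t + deriv (cgf Y P) t * (t' - t) ≤ cgf Y P t' := by
  have hd := (analyticAt_cgf ht).differentiableAt
  rcases lt_trichotomy t t' with htt' | rfl | htt'
  · have hslope := convexOn_cgf.deriv_le_slope ht ht' htt' hd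
    rw [slope_def_field, le_div_iff₀ (sub_pos.2 htt')] at hslope
    linarith
  · simp
  · have hslope := convexOn_cgf.slope_le_deriv ht' ht htt' hd
    rw [slope_def_field, div_le_iff₀ (sub_pos.2 htt')] at hslope
    linarith

lemma isGreatest_legendreValues (ht : t ∈ interior (integrableExpSet Y P)) :
    IsGreatest (legendreValues Y P (deriv (cgf Y P) t))
      (t * deriv (cgf Y P) t - cgf Y P t) := by
  have ht' := mem_interior_integrableExpSet_iff.1 ht
  refine ⟨⟨t, ht'.1, ht'.2, rfl⟩, ?_⟩
  rintro _ ⟨s, hs, hs', rfl⟩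
  have := cgf_add_deriv_mul_le ht (mem_interior_integrableExpSet_iff.2 ⟨hs, hs'⟩)
  linarith

lemma rate_deriv_cgf (ht : t ∈ interior (integrableExpSet Y P)) :
    rate Y P (deriv (cgf Y P) t) = t * deriv (cgf Y P) t - cgf Y P t :=
  (isGreatest_legendreValues ht).csSup_eq

lemma exists_abs_rate_deriv_cgf_le (hI : Set.Icc a b ⊆ interior (integrableExpSet Y P)) :
    ∃ Λ, ∀ t ∈ Set.Icc a b, |rate Y P (deriv (cgf Y P) t)| ≤ Λ := by
  have hA : AnalyticOnNhd ℝ (cgf Y P) (Set.Icc a b) := analyticOnNhd_cgf.mono hI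
  obtain ⟨Λ, hΛ⟩ := isCompact_Icc.exists_bound_of_continuousOn
    ((continuousOn_id.mul hA.deriv.continuousOn).sub hA.continuousOn)
  refine ⟨Λ, fun t ht => ?_⟩
  rw [rate_deriv_cgf (hI ht)]
  exact hΛ t ht

lemma lipschitzOnWith_rate (hI : Set.Icc a b ⊆ interior (integrableExpSet Y P)) :
    LipschitzOnWith (max ‖a‖₊ ‖b‖₊) (rate Y P) (deriv (cgf Y P) '' Set.Icc a b) := by
  refine LipschitzOnWith.of_le_add_mul _ ?_
  rintro _ ⟨s, hs, rfl⟩ _ ⟨t, ht, rfl⟩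
  have htangent := cgf_add_deriv_mul_le (hI ht) (hI hs)
  have hle : s * (deriv (cgf Y P) s - deriv (cgf Y P) t) ≤
      max |a| |b| * |deriv (cgf Y P) s - deriv (cgf Y P) t| :=
    calc s * (deriv (cgf Y P) s - deriv (cgf Y P) t)
        ≤ |s| * |deriv (cgf Y P) s - deriv (cgf Y P) t| :=
          (le_abs_self _).trans_eq (abs_mul _ _)
      _ ≤ _ := by
          gcongr
          exact abs_le_max_abs_abs hs.1 hs.2
  rw [rate_deriv_cgf (hI hs), rate_deriv_cgf (hI ht), Real.dist_eq, NNReal.coe_max, coe_nnnorm,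
    coe_nnnorm, Real.norm_eq_abs, Real.norm_eq_abs]
  linarith

lemma exp_mul_le_exp_mul_add_exp_mul (ht : t ∈ Set.Icc a b) (y : ℝ) :
    Real.exp (t * y) ≤ Real.exp (a * y) + Real.exp (b * y) := by
  rcases le_total 0 y with hy | hy
  · exact (Real.exp_le_exp.2 (mul_le_mul_of_nonneg_right ht.2 hy)).trans
      (le_add_of_nonneg_left (Real.exp_pos _).le)
  · exact (Real.exp_le_exp.2 (mul_le_mul_of_nonpos_right ht.1 hy)).trans
      (le_add_of_nonneg_right (Real.exp_pos _).le)

lemma exists_integral_abs_pow_tilted_le (hab : a ≤ b)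
    (hI : Set.Icc a b ⊆ interior (integrableExpSet Y P)) (p : ℕ) :
    ∃ M : ℝ, ∀ t ∈ Set.Icc a b, ∫ ω, |Y ω| ^ p ∂(P.tilted (fun ω => t * Y ω)) ≤ M := by
  obtain ⟨H, hH⟩ := isCompact_Icc.exists_bound_of_continuousOn
    (analyticOnNhd_cgf.mono hI).continuousOn
  have hint : ∀ t ∈ Set.Icc a b, Integrable (fun ω => |Y ω| ^ p * Real.exp (t * Y ω)) P :=
    fun t ht => integrable_pow_abs_mul_exp_of_mem_interior_integrableExpSet (hI ht) p
  have hdom : Integrable (fun ω => Real.exp H *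
      (|Y ω| ^ p * Real.exp (a * Y ω) + |Y ω| ^ p * Real.exp (b * Y ω))) P :=
    ((hint a ⟨le_rfl, hab⟩).add (hint b ⟨hab, le_rfl⟩)).const_mul _
  refine ⟨∫ ω, Real.exp H *
    (|Y ω| ^ p * Real.exp (a * Y ω) + |Y ω| ^ p * Real.exp (b * Y ω)) ∂P, fun t ht => ?_⟩
  have hti : t ∈ integrableExpSet Y P := interior_subset (hI ht)
  rw [integral_tilted_mul_eq_cgf _ hti]
  refine integral_mono_of_nonneg (Filter.Eventually.of_forall fun ω => ?_) hdom
    (Filter.Eventually.of_forall fun ω => ?_)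
  · exact smul_nonneg (Real.exp_pos _).le (by positivity)
  calc Real.exp (t * Y ω - cgf Y P t) • |Y ω| ^ p
      = Real.exp (-cgf Y P t) * (|Y ω| ^ p * Real.exp (t * Y ω)) := by
        rw [smul_eq_mul, sub_eq_neg_add, Real.exp_add]
        ring
    _ ≤ Real.exp H * (|Y ω| ^ p * (Real.exp (a * Y ω) + Real.exp (b * Y ω))) := by
        gcongr
        · exact (neg_le_abs _).trans (hH t ht)
        · exact exp_mul_le_exp_mul_add_exp_mul ht _
    _ = _ := by rw [mul_add (|Y ω| ^ p)]

variable [IsProbabilityMeasure P]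

lemma deriv_deriv_cgf_pos (ht : t ∈ interior (integrableExpSet Y P))
    (hY : ∀ c : ℝ, ¬ ∀ᵐ ω ∂P, Y ω = c) : 0 < deriv (deriv (cgf Y P)) t := by
  have hti : t ∈ integrableExpSet Y P := interior_subset ht
  have := isProbabilityMeasure_tilted hti
  rw [deriv_deriv_cgf ht]
  refine (variance_nonneg _ _).lt_of_ne fun h0 => ?_
  have hL : MemLp Y 2 (P.tilted (t * Y ·)) := mod_cast memLp_tilted_mul ht 2
  exact hY _ ((absolutelyContinuous_tilted hti).ae_le
    (ae_eq_integral_of_variance_eq_zero hL h0.symm))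

lemma exists_bilipschitz_deriv_cgf (hab : a ≤ b)
    (hI : Set.Icc a b ⊆ interior (integrableExpSet Y P)) (hY : ∀ c : ℝ, ¬ ∀ᵐ ω ∂P, Y ω = c) :
    ∃ κ κ' : ℝ, 0 < κ ∧ 0 < κ' ∧ ∀ s ∈ Set.Icc a b, ∀ t ∈ Set.Icc a b, s ≤ t →
      κ * (t - s) ≤ deriv (cgf Y P) t - deriv (cgf Y P) s ∧
      deriv (cgf Y P) t - deriv (cgf Y P) s ≤ κ' * (t - s) :=
  have hA1 : AnalyticOnNhd ℝ (deriv (cgf Y P)) (Set.Icc a b) := (analyticOnNhd_cgf.mono hI).deriv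
  exists_bilipschitz_of_deriv_pos hab hA1.continuousOn
    (fun t ht => (hA1 t (Set.Ioo_subset_Icc_self ht)).differentiableAt.hasDerivAt)
    hA1.deriv.continuousOn fun _ ht => deriv_deriv_cgf_pos (hI ht) hY

lemma measure_integral_lt_pos (hYi : Integrable Y P)
    (hY : ¬ ∀ᵐ ω ∂P, Y ω = ∫ ω, Y ω ∂P) : 0 < P {ω | ∫ ω, Y ω ∂P < Y ω} := by
  refine pos_iff_ne_zero.2 fun h0 => hY ?_
  have hle : ∀ᵐ ω ∂P, Y ω ≤ ∫ ω, Y ω ∂P := by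
    filter_upwards [measure_eq_zero_iff_ae_notMem.1 h0] with ω hω using not_lt.1 hω
  exact (integral_eq_iff_of_ae_le hYi (integrable_const _) hle).1 (by simp)

lemma measure_lt_deriv_cgf_pos (ht : t ∈ interior (integrableExpSet Y P))
    (hY : ∀ c : ℝ, ¬ ∀ᵐ ω ∂P, Y ω = c) :
    0 < P {ω | deriv (cgf Y P) t < Y ω} ∧ 0 < P {ω | Y ω < deriv (cgf Y P) t} := by
  have hti : t ∈ integrableExpSet Y P := interior_subset ht
  have := isProbabilityMeasure_tilted hti
  have hint : Integrable Y (P.tilted (t * Y ·)) :=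
    memLp_one_iff_integrable.1 (mod_cast memLp_tilted_mul ht 1)
  have hmean := integral_tilted_mul_self ht
  have hne : ∀ c, ¬ ∀ᵐ ω ∂(P.tilted (t * Y ·)), Y ω = c := fun c h =>
    hY c ((absolutelyContinuous_tilted hti).ae_le h)
  have hpos : ∀ {s : Set Ω}, 0 < P.tilted (t * Y ·) s → 0 < P s := fun hs =>
    pos_iff_ne_zero.2 fun h => hs.ne' (tilted_absolutelyContinuous P _ h)
  constructor
  · rw [← hmean]
    exact hpos (measure_integral_lt_pos hint (hne _))
  · have hneg := hpos (measure_integral_lt_pos hint.neg fun h => hne (deriv (cgf Y P) t) ?_)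
    · simpa only [Pi.neg_apply, integral_neg, hmean, neg_lt_neg_iff] using hneg
    · simpa only [Pi.neg_apply, integral_neg, hmean, neg_inj] using h

lemma exists_mem_atoms_gt (ht : t ∈ interior (integrableExpSet (fun ω => (ξ ω : ℝ)) P))
    (hξ : ∀ c : ℝ, ¬ ∀ᵐ ω ∂P, (ξ ω : ℝ) = c) :
    ∃ j ∈ atoms P ξ, deriv (cgf (fun ω => (ξ ω : ℝ)) P) t < j := by
  have hfreq := frequently_ae_iff.2 (measure_lt_deriv_cgf_pos ht hξ).1.ne'
  obtain ⟨ω, hlt, hω⟩ := (hfreq.and_eventually (ae_mem_atoms (ξ := ξ))).exists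
  exact ⟨ξ ω, hω, hlt⟩

lemma exists_mem_atoms_lt (ht : t ∈ interior (integrableExpSet (fun ω => (ξ ω : ℝ)) P))
    (hξ : ∀ c : ℝ, ¬ ∀ᵐ ω ∂P, (ξ ω : ℝ) = c) :
    ∃ j ∈ atoms P ξ, j < deriv (cgf (fun ω => (ξ ω : ℝ)) P) t := by
  have hfreq := frequently_ae_iff.2 (measure_lt_deriv_cgf_pos ht hξ).2.ne'
  obtain ⟨ω, hlt, hω⟩ := (hfreq.and_eventually (ae_mem_atoms (ξ := ξ))).exists
  exact ⟨ξ ω, hω, hlt⟩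

lemma exists_pos_mul_le_integral_tilted (hξ : Measurable ξ) (hab : a ≤ b)
    (hI : Set.Icc a b ⊆ interior (integrableExpSet (fun ω => (ξ ω : ℝ)) P)) {j : ℤ}
    (hj : j ∈ atoms P ξ) : ∃ q : ℝ, 0 < q ∧ ∀ t ∈ Set.Icc a b, ∀ F : ℤ → ℝ, (∀ x, 0 ≤ F x) →
      Integrable (fun ω => F (ξ ω)) (P.tilted (fun ω => t * (ξ ω : ℝ))) →
        q * F j ≤ ∫ ω, F (ξ ω) ∂(P.tilted (fun ω => t * (ξ ω : ℝ))) := by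
  set H := cgf (fun ω => (ξ ω : ℝ)) P
  have hcont : ContinuousOn (fun t => Real.exp (t * j - H t)) (Set.Icc a b) :=
    Real.continuous_exp.comp_continuousOn
      ((continuousOn_id.mul continuousOn_const).sub (analyticOnNhd_cgf.mono hI).continuousOn)
  obtain ⟨t₀, -, hmin⟩ := isCompact_Icc.exists_isMinOn (Set.nonempty_Icc.2 hab) hcont
  refine ⟨Real.exp (t₀ * j - H t₀) * P.real {ω | ξ ω = j},
    mul_pos (Real.exp_pos _) (ENNReal.toReal_pos hj.ne' (measure_ne_top _ _)),
    fun t ht F hF hFi => ?_⟩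
  have hti : t ∈ integrableExpSet (fun ω => (ξ ω : ℝ)) P := interior_subset (hI ht)
  have hm : MeasurableSet {ω | ξ ω = j} := hξ (measurableSet_singleton j)
  calc Real.exp (t₀ * j - H t₀) * P.real {ω | ξ ω = j} * F j
      ≤ Real.exp (t * j - H t) * P.real {ω | ξ ω = j} * F j := by
        gcongr ?_ * _ * _
        exacts [hF j, hmin ht]
    _ = ∫ _ in {ω | ξ ω = j}, Real.exp (t * j - H t) * F j ∂P := by
        rw [setIntegral_const, smul_eq_mul]
        ring
    _ = ∫ ω in {ω | ξ ω = j}, F (ξ ω) ∂(P.tilted (fun ω => t * (ξ ω : ℝ))) := by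
        rw [setIntegral_tilted_mul_eq_cgf (X := fun ω => (ξ ω : ℝ)) _ _ hti]
        refine setIntegral_congr_fun hm fun _ (hω : ξ _ = j) => ?_
        simp only [hω, smul_eq_mul, H]
    _ ≤ ∫ ω, F (ξ ω) ∂(P.tilted (fun ω => t * (ξ ω : ℝ))) :=
        setIntegral_le_integral hFi (Filter.Eventually.of_forall fun ω => hF _)

lemma abs_sub_cube_le {m B : ℝ} (hm : |m| ≤ B) (y : ℝ) :
    |y - m| ^ 3 ≤ 4 * (|y| ^ 3 + B ^ 3) :=
  calc |y - m| ^ 3 ≤ (|y| + B) ^ 3 :=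
        pow_le_pow_left₀ (abs_nonneg _) ((abs_sub _ _).trans (add_le_add_right hm _)) 3
    _ ≤ 2 ^ (3 - 1) * (|y| ^ 3 + B ^ 3) := add_pow_le (abs_nonneg y) ((abs_nonneg m).trans hm) 3
    _ = 4 * (|y| ^ 3 + B ^ 3) := by norm_num

lemma exists_integral_abs_sub_cube_tilted_le (hab : a ≤ b)
    (hI : Set.Icc a b ⊆ interior (integrableExpSet Y P)) :
    ∃ M : ℝ, ∀ t ∈ Set.Icc a b,
      ∫ ω, |Y ω - deriv (cgf Y P) t| ^ 3 ∂(P.tilted (fun ω => t * Y ω)) ≤ M := by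
  obtain ⟨B, hB⟩ := isCompact_Icc.exists_bound_of_continuousOn
    (analyticOnNhd_cgf.mono hI).deriv.continuousOn
  obtain ⟨M, hM⟩ := exists_integral_abs_pow_tilted_le hab hI 3
  refine ⟨4 * (M + B ^ 3), fun t ht => ?_⟩
  have hti : t ∈ integrableExpSet Y P := interior_subset (hI ht)
  have := isProbabilityMeasure_tilted hti
  have hcube : Integrable (fun ω => |Y ω| ^ 3) (P.tilted (fun ω => t * Y ω)) := by
    have hL : MemLp Y 3 (P.tilted (fun ω => t * Y ω)) := mod_cast memLp_tilted_mul (hI ht) 3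
    simpa using hL.integrable_norm_pow (p := 3) (by norm_num)
  have hdom : Integrable (fun ω => 4 * (|Y ω| ^ 3 + B ^ 3)) (P.tilted (fun ω => t * Y ω)) :=
    (hcube.add (integrable_const (B ^ 3))).const_mul 4
  calc ∫ ω, |Y ω - deriv (cgf Y P) t| ^ 3 ∂(P.tilted (fun ω => t * Y ω))
      ≤ ∫ ω, 4 * (|Y ω| ^ 3 + B ^ 3) ∂(P.tilted (fun ω => t * Y ω)) :=
        integral_mono_of_nonneg (Filter.Eventually.of_forall fun ω => pow_nonneg (abs_nonneg _) 3)
          hdom (Filter.Eventually.of_forall fun ω => abs_sub_cube_le (hB t ht) (Y ω))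
    _ = 4 * (∫ ω, |Y ω| ^ 3 ∂(P.tilted (fun ω => t * Y ω)) + B ^ 3) := by
        rw [integral_const_mul, integral_add hcube (integrable_const _), integral_const,
          probReal_univ, one_smul]
    _ ≤ 4 * (M + B ^ 3) := by
        gcongr
        exact hM t ht

lemma exists_centred_tilted (hξ : Measurable ξ) (hab : a ≤ b)
    (hI : Set.Icc a b ⊆ interior (integrableExpSet (fun ω => (ξ ω : ℝ)) P))
    (hnd : ∀ c : ℝ, ¬ ∀ᵐ ω ∂P, (ξ ω : ℝ) = c) :
    ∃ v M : ℝ, 0 < v ∧ ∀ t ∈ Set.Icc a b, Centred (P.tilted (fun ω => t * (ξ ω : ℝ)))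
      (fun ω => ξ ω - deriv (cgf (fun ω => (ξ ω : ℝ)) P) t) v M := by
  set m := deriv (cgf (fun ω => (ξ ω : ℝ)) P)
  have haI := hI (Set.left_mem_Icc.2 hab)
  have hbI := hI (Set.right_mem_Icc.2 hab)
  obtain ⟨M, hM⟩ := exists_integral_abs_sub_cube_tilted_le hab hI
  obtain ⟨jp, hjp, hmjp⟩ := exists_mem_atoms_gt hbI hnd
  obtain ⟨jm, hjm, hjmm⟩ := exists_mem_atoms_lt haI hnd
  obtain ⟨qp, hqp, hp⟩ := exists_pos_mul_le_integral_tilted hξ hab hI hjp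
  obtain ⟨qm, hqm, hm⟩ := exists_pos_mul_le_integral_tilted hξ hab hI hjm
  have hmjp' : 0 < jp - m b := sub_pos.2 hmjp
  have hjmm' : 0 < m a - jm := sub_pos.2 hjmm
  refine ⟨min (qp * (jp - m b) ^ 2) (qm * (m a - jm) ^ 2), M,
    lt_min (mul_pos hqp (pow_pos hmjp' 2)) (mul_pos hqm (pow_pos hjmm' 2)), fun t ht => ?_⟩
  have hti : t ∈ integrableExpSet (fun ω => (ξ ω : ℝ)) P := interior_subset (hI ht)
  have := isProbabilityMeasure_tilted hti
  have hL : MemLp (fun ω => ξ ω - m t) 3 (P.tilted (fun ω => t * (ξ ω : ℝ))) :=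
    MemLp.sub (mod_cast memLp_tilted_mul (hI ht) 3) (memLp_const _)
  have hsq := (hL.mono_exponent (p := 2) (by norm_num)).integrable_sq
  have hmt : m t ≤ m b := monotoneOn_deriv_cgf (hI ht) hbI ht.2
  have hmt' : m a ≤ m t := monotoneOn_deriv_cgf haI (hI ht) ht.1
  refine ⟨hL, ?_, hM t ht, (min_le_left _ _).trans ?_, (min_le_right _ _).trans ?_⟩
  · rw [integral_sub ?_ (integrable_const _), integral_tilted_mul_self (hI ht), integral_const,
      probReal_univ, one_smul, sub_self]
    exact memLp_one_iff_integrable.1 (mod_cast memLp_tilted_mul (hI ht) 1)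
  · refine le_trans ?_ (hp t ht (fun x => max (x - m t) 0 ^ 2) (fun x => by positivity) ?_)
    · gcongr
      exact le_max_of_le_left (by gcongr)
    · exact hsq.mono' (by fun_prop) (Filter.Eventually.of_forall fun ω => by
        rw [Real.norm_of_nonneg (by positivity)]; exact max_zero_sq_le_sq _)
  · refine le_trans ?_ (hm t ht (fun x => max (-(x - m t)) 0 ^ 2) (fun x => by positivity) ?_)
    · gcongr
      exact le_max_of_le_left (by linarith)
    · exact hsq.mono' (by fun_prop) (Filter.Eventually.of_forall fun ω => by
        rw [Real.norm_of_nonneg (by positivity), ← neg_sq (_ - _)]; exact max_zero_sq_le_sq _)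

end Tilt

section RiemannSum

open scoped NNReal

variable {J : ℝ → ℝ} {K : ℝ≥0}

lemma abs_mul_sub_integral_le {x y p : ℝ} (hJ : LipschitzOnWith K J (Set.Icc x y))
    (hp : p ∈ Set.Icc x y) : |(y - x) * J p - ∫ s in x..y, J s| ≤ K * (y - x) ^ 2 := by
  have hxy : x ≤ y := hp.1.trans hp.2
  have hint : IntervalIntegrable J volume x y :=
    (hJ.continuousOn.mono (Set.uIcc_of_le hxy).subset).intervalIntegrable
  have herr : ∀ s ∈ Set.uIoc x y, ‖J p - J s‖ ≤ K * (y - x) := by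
    intro s hs
    rw [Set.uIoc_of_le hxy] at hs
    have hs' : s ∈ Set.Icc x y := Set.Ioc_subset_Icc_self hs
    calc ‖J p - J s‖ ≤ K * ‖p - s‖ := hJ.norm_sub_le hp hs'
      _ ≤ K * (y - x) := by
          gcongr
          exact abs_le.2 ⟨by linarith [hp.1, hs.2], by linarith [hp.2, hs.1]⟩
  calc |(y - x) * J p - ∫ s in x..y, J s| = ‖∫ s in x..y, (J p - J s)‖ := by
        rw [intervalIntegral.integral_sub intervalIntegrable_const hint,
          intervalIntegral.integral_const, smul_eq_mul, Real.norm_eq_abs]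
    _ ≤ K * (y - x) * |y - x| := intervalIntegral.norm_integral_le_of_norm_le_const herr
    _ = K * (y - x) ^ 2 := by rw [abs_of_nonneg (sub_nonneg.2 hxy)]; ring

lemma Icc_div_subset_unit {n k : ℕ} (hk : k < n) :
    Set.Icc ((k : ℝ) / n) ((k + 1 : ℕ) / n) ⊆ Set.Icc 0 1 :=
  Set.Icc_subset_Icc (by positivity)
    (div_le_one_of_le₀ (mod_cast Nat.succ_le_of_lt hk) n.cast_nonneg)

lemma abs_riemannSum_sub_le (hJ : LipschitzOnWith K J (Set.Icc 0 1)) {n : ℕ} (hn : 0 < n)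
    {p : ℕ → ℝ} (hp : ∀ k < n, p k ∈ Set.Icc ((k : ℝ) / n) ((k + 1 : ℕ) / n)) :
    |∑ k ∈ Finset.range n, J (p k) - n * ∫ s in (0 : ℝ)..1, J s| ≤ K := by
  have hn0 : (0 : ℝ) < n := mod_cast hn
  have hwidth : ∀ k : ℕ, ((k + 1 : ℕ) : ℝ) / n - k / n = (n : ℝ)⁻¹ := fun k => by
    push_cast
    ring
  have hJk : ∀ k < n, LipschitzOnWith K J (Set.Icc ((k : ℝ) / n) ((k + 1 : ℕ) / n)) :=
    fun k hk => hJ.mono (Icc_div_subset_unit hk)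
  have hsplit : ∑ k ∈ Finset.range n, ∫ s in ((k : ℝ) / n)..((k + 1 : ℕ) / n), J s =
      ∫ s in (0 : ℝ)..1, J s := by
    rw [intervalIntegral.sum_integral_adjacent_intervals (a := fun k : ℕ => (k : ℝ) / n)]
    · rw [Nat.cast_zero, zero_div, div_self hn0.ne']
    · intro k hk
      refine ((hJk k hk).continuousOn.mono (Set.uIcc_of_le ?_).subset).intervalIntegrable
      exact (hp k hk).1.trans (hp k hk).2
  calc |∑ k ∈ Finset.range n, J (p k) - n * ∫ s in (0 : ℝ)..1, J s|
      = |∑ k ∈ Finset.range n, n * ((((k + 1 : ℕ) : ℝ) / n - k / n) * J (p k) -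
          ∫ s in ((k : ℝ) / n)..((k + 1 : ℕ) / n), J s)| := by
        simp only [hwidth, mul_sub, mul_inv_cancel_left₀ hn0.ne', Finset.sum_sub_distrib]
        rw [← Finset.mul_sum, hsplit]
    _ ≤ ∑ k ∈ Finset.range n, n * (K * (((k + 1 : ℕ) : ℝ) / n - k / n) ^ 2) := by
        refine (Finset.abs_sum_le_sum_abs _ _).trans (Finset.sum_le_sum fun k hk => ?_)
        rw [abs_mul, Nat.abs_cast]
        have hkn := Finset.mem_range.1 hk
        gcongr
        exact abs_mul_sub_integral_le (hJk k hkn) (hp k hkn)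
    _ = K := by
        simp only [hwidth, Finset.sum_const, Finset.card_range, nsmul_eq_mul]
        field_simp

end RiemannSum

section Obstacle

variable {f h : ℝ → ℝ} {n k : ℕ}

lemma hasDerivAt_unitDeriv (hf : DifferentiableOn ℝ f (Set.Icc 0 1)) {x : ℝ}
    (hx : x ∈ Set.Ioo (0 : ℝ) 1) : HasDerivAt f (unitDeriv f x) x :=
  (hf x (Set.Ioo_subset_Icc_self hx)).hasDerivWithinAt.hasDerivAt (Icc_mem_nhds hx.1 hx.2)

lemma contDiffOn_unitDeriv (hC2 : ContDiffOn ℝ 2 h (Set.Icc 0 1)) :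
    ContDiffOn ℝ 1 (unitDeriv h) (Set.Icc 0 1) :=
  hC2.derivWithin (uniqueDiffOn_Icc zero_lt_one) (by norm_num)

lemma exists_bilipschitz_unitDeriv (hC2 : ContDiffOn ℝ 2 h (Set.Icc 0 1))
    (hneg : ∀ s ∈ Set.Icc (0 : ℝ) 1, unitDeriv (unitDeriv h) s < 0) :
    ∃ m L : ℝ, 0 < m ∧ 0 < L ∧ ∀ s ∈ Set.Icc (0 : ℝ) 1, ∀ s' ∈ Set.Icc (0 : ℝ) 1, s ≤ s' →
      m * (s' - s) ≤ unitDeriv h s - unitDeriv h s' ∧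
      unitDeriv h s - unitDeriv h s' ≤ L * (s' - s) := by
  have hd := contDiffOn_unitDeriv hC2
  obtain ⟨m, L, hm, hL, hb⟩ := exists_bilipschitz_of_deriv_pos zero_le_one hd.continuousOn.neg
    (fun x hx => (hasDerivAt_unitDeriv (hd.differentiableOn one_ne_zero) hx).neg)
    (hd.continuousOn_derivWithin (uniqueDiffOn_Icc zero_lt_one) le_rfl).neg
    fun x hx => neg_pos.2 (hneg x hx)
  refine ⟨m, L, hm, hL, fun s hs s' hs' hss' => ?_⟩
  simpa only [Pi.neg_apply, neg_sub_neg] using hb s hs s' hs' hss'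

lemma exists_unitDeriv_eq_obstacle_sub (hd : DifferentiableOn ℝ h (Set.Icc 0 1)) (hk : k < n) :
    ∃ s ∈ Set.Icc ((k : ℝ) / n) ((k + 1 : ℕ) / n),
      obstacle h n (k + 1) - obstacle h n k = unitDeriv h s := by
  have hn : (0 : ℝ) < n := mod_cast k.zero_le.trans_lt hk
  have hlt : (k : ℝ) / n < (k + 1 : ℕ) / n := by gcongr; exact k.lt_succ_self
  have hsub := Icc_div_subset_unit hk
  obtain ⟨s, hs, hslope⟩ := exists_hasDerivAt_eq_slope h (unitDeriv h) hlt
    (hd.continuousOn.mono hsub) fun s hs => hasDerivAt_unitDeriv hd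
      ⟨(hsub (Set.left_mem_Icc.2 hlt.le)).1.trans_lt hs.1,
        hs.2.trans_le (hsub (Set.right_mem_Icc.2 hlt.le)).2⟩
  refine ⟨s, Set.Ioo_subset_Icc_self hs, ?_⟩
  rw [hslope, obstacle, obstacle]
  push_cast
  field_simp
  ring

-- The mean value theorem is applied to the difference of `h` and its shift by `1 / n`.
lemma exists_unitDeriv_sub_eq_obstacle_sub_sub (hd : DifferentiableOn ℝ h (Set.Icc 0 1))
    (hk : k + 2 ≤ n) : ∃ s : ℝ, 0 ≤ s ∧ s + (n : ℝ)⁻¹ ≤ 1 ∧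
      obstacle h n (k + 1) - obstacle h n k - (obstacle h n (k + 2) - obstacle h n (k + 1)) =
        unitDeriv h s - unitDeriv h (s + (n : ℝ)⁻¹) := by
  have hn : (0 : ℝ) < n := mod_cast (by lia : 0 < n)
  set x : ℝ := k / n with hx
  set η : ℝ := (n : ℝ)⁻¹ with hη
  have hη0 : 0 < η := by positivity
  have hx0 : 0 ≤ x := by positivity
  have hx2 : x + η + η ≤ 1 := by
    have hk' : (k : ℝ) + 2 ≤ n := mod_cast hk
    calc x + η + η = ((k : ℝ) + 2) / n := by rw [hx, hη]; ring
      _ ≤ 1 := div_le_one_of_le₀ hk' hn.le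
  obtain ⟨s, hs, hslope⟩ := exists_hasDerivAt_eq_slope (fun s => h s - h (s + η))
    (fun s => unitDeriv h s - unitDeriv h (s + η)) (show x < x + η by linarith)
    ((hd.continuousOn.mono (Set.Icc_subset_Icc hx0 (by linarith))).sub
      (hd.continuousOn.comp (by fun_prop) fun s hs => by constructor <;> linarith [hs.1, hs.2]))
    fun s hs => (hasDerivAt_unitDeriv hd ⟨by linarith [hs.1], by linarith [hs.2]⟩).sub
      ((hasDerivAt_unitDeriv hd ⟨by linarith [hs.1], by linarith [hs.2]⟩).comp_add_const s η)
  refine ⟨s, by linarith [hs.1], by linarith [hs.2], ?_⟩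
  have e1 : ((k + 1 : ℕ) : ℝ) / n = x + η := by rw [hx, hη]; push_cast; ring
  have e2 : ((k + 2 : ℕ) : ℝ) / n = x + η + η := by rw [hx, hη]; push_cast; ring
  rw [hslope, obstacle, obstacle, obstacle, e1, e2, ← hx, add_sub_cancel_left, hη, div_inv_eq_mul]
  ring

end Obstacle

section TiltSchedule

variable {Ω : Type*} [MeasurableSpace Ω] {P : Measure Ω} {Y : Ω → ℝ} {a b : ℝ}

/-- Tilts `τ (k + 1) ∈ [a, b]` under which the step from time `k` to time `k + 1` has the slope
`c (k + 1) - c k` of the obstacle as its mean. They decrease at the rate `1 / n`; the value `τ 0`,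
which is not used by any step, extends this decrease to time `0`. -/
structure TiltSchedule (P : Measure Ω) (Y : Ω → ℝ) (a b c₁ c₂ A : ℝ) (n : ℕ) (c τ : ℕ → ℝ) :
    Prop where
  mem : ∀ k < n, τ (k + 1) ∈ Set.Icc a b
  deriv_eq : ∀ k < n, deriv (cgf Y P) (τ (k + 1)) = c (k + 1) - c k
  le_drop : ∀ k < n, c₁ / n ≤ τ k - τ (k + 1)
  drop_le : ∀ k < n, τ k - τ (k + 1) ≤ c₂ / n
  abs_le : ∀ k ≤ n, |τ k| ≤ A

lemma TiltSchedule.sub_mem_Icc {c₁ c₂ A : ℝ} {n : ℕ} {c τ : ℕ → ℝ}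
    (hτ : TiltSchedule P Y a b c₁ c₂ A n c τ) (hI : Set.Icc a b ⊆ interior (integrableExpSet Y P))
    {k : ℕ} (hk : k < n) :
    c (k + 1) - c k ∈ Set.Icc (deriv (cgf Y P) a) (deriv (cgf Y P) b) := by
  obtain ⟨ha, hb⟩ := hτ.mem k hk
  have hab := ha.trans hb
  rw [← hτ.deriv_eq k hk]
  exact ⟨monotoneOn_deriv_cgf (hI (Set.left_mem_Icc.2 hab)) (hI ⟨ha, hb⟩) ha,
    monotoneOn_deriv_cgf (hI ⟨ha, hb⟩) (hI (Set.right_mem_Icc.2 hab)) hb⟩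

lemma drop_bounds_of_bilipschitz {H : ℝ → ℝ} {κ κ' m L : ℝ} (hκ : 0 < κ) (hκ' : 0 < κ')
    (hH : ∀ s ∈ Set.Icc a b, ∀ t ∈ Set.Icc a b, s ≤ t →
      κ * (t - s) ≤ H t - H s ∧ H t - H s ≤ κ' * (t - s))
    {s t : ℝ} (hs : s ∈ Set.Icc a b) (ht : t ∈ Set.Icc a b) (hm : 0 < m)
    (hmst : m ≤ H t - H s) (hLst : H t - H s ≤ L) : m / κ' ≤ t - s ∧ t - s ≤ L / κ := by
  have hst : s ≤ t := by
    by_contra! hts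
    linarith [(hH t ht s hs hts.le).1, mul_pos hκ (sub_pos.2 hts)]
  rw [div_le_iff₀' hκ', le_div_iff₀' hκ]
  exact ⟨hmst.trans (hH s hs t ht hst).2, (hH s hs t ht hst).1.trans hLst⟩

lemma exists_tiltSchedule [IsProbabilityMeasure P] (hab : a ≤ b)
    (hI : Set.Icc a b ⊆ interior (integrableExpSet Y P)) (hY : ∀ c : ℝ, ¬ ∀ᵐ ω ∂P, Y ω = c)
    {m : ℝ} (hm : 0 < m) (L : ℝ) :
    ∃ c₁ c₂ A : ℝ, 0 < c₁ ∧ 0 < c₂ ∧ ∀ n : ℕ, 0 < n → ∀ c : ℕ → ℝ,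
      (∀ k < n, c (k + 1) - c k ∈ deriv (cgf Y P) '' Set.Icc a b) →
      (∀ k, k + 2 ≤ n → m / n ≤ c (k + 1) - c k - (c (k + 2) - c (k + 1)) ∧
        c (k + 1) - c k - (c (k + 2) - c (k + 1)) ≤ L / n) →
      ∃ τ, TiltSchedule P Y a b c₁ c₂ A n c τ := by
  obtain ⟨κ, κ', hκ, hκ', hH⟩ := exists_bilipschitz_deriv_cgf hab hI hY
  set c₁ := m / κ' with hc₁
  have hc₁0 : 0 < c₁ := div_pos hm hκ'
  refine ⟨c₁, max (L / κ) c₁, max |a| |b| + c₁, hc₁0, lt_max_of_lt_right hc₁0,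
    fun n hn c hslope hcurv => ?_⟩
  have hn1 : (1 : ℝ) ≤ n := mod_cast hn
  choose! T hT using hslope
  have hdrop : ∀ k, k + 2 ≤ n → c₁ / n ≤ T k - T (k + 1) ∧ T k - T (k + 1) ≤ L / κ / n := by
    intro k hk
    obtain ⟨hlo, hhi⟩ := hcurv k hk
    rw [← (hT k (by lia)).2, ← (hT (k + 1) (by lia)).2] at hlo hhi
    rw [hc₁, div_right_comm, div_right_comm L]
    exact drop_bounds_of_bilipschitz hκ hκ' hH (hT (k + 1) (by lia)).1 (hT k (by lia)).1
      (by positivity) hlo hhi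
  have habs : ∀ k < n, |T k| ≤ max |a| |b| := fun k hk =>
    abs_le_max_abs_abs (hT k hk).1.1 (hT k hk).1.2
  refine ⟨fun k => if k = 0 then T 0 + c₁ / n else T (k - 1), fun k hk => (hT k hk).1,
    fun k hk => (hT k hk).2, fun k hk => ?_, fun k hk => ?_, fun k hk => ?_⟩
  · obtain _ | k := k
    · simp
    · simpa using (hdrop k hk).1
  · obtain _ | k := k
    · simp only [if_true, zero_add, one_ne_zero, if_false, Nat.sub_self, add_sub_cancel_left]
      gcongr
      exact le_max_right _ _
    · simpa using (hdrop k hk).2.trans (by gcongr; exact le_max_left _ _)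
  · obtain _ | k := k
    · calc |T 0 + c₁ / n| ≤ |T 0| + |c₁ / n| := abs_add_le _ _
        _ ≤ max |a| |b| + c₁ := by
          rw [abs_of_pos (div_pos hc₁0 (zero_lt_one.trans_le hn1))]
          exact add_le_add (habs 0 hn) (div_le_self hc₁0.le hn1)
    · simpa using (habs k hk).trans (le_add_of_nonneg_right hc₁0.le)

end TiltSchedule

section Comparison

variable {Ω : Type*} [MeasurableSpace Ω] {P : Measure Ω} {ξ : Ω → ℤ} {G : ℝ → ℝ} {c τ : ℕ → ℝ}

/-- The functions of the height above the obstacle that serve as comparison profiles. -/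
structure IsProfile (G : ℝ → ℝ) : Prop where
  measurable : Measurable G
  nonneg : ∀ y, 0 ≤ G y
  le_two : ∀ y, G y ≤ 2
  eq_zero_of_neg : ∀ y < 0, G y = 0

lemma isProfile_satProfile {ε : ℝ} (hε : 0 < ε) : IsProfile fun y => satProfile (ε * y) where
  measurable := measurable_satProfile.comp (measurable_const_mul ε)
  nonneg _ := satProfile_nonneg _
  le_two _ := satProfile_le_two _
  eq_zero_of_neg _ hy := satProfile_of_neg (mul_neg_of_pos_of_neg hε hy)

lemma isProfile_bump {ε R : ℝ} (hε : 0 < ε) (hR : 1 ≤ R) :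
    IsProfile fun y => bump (ε * y - R) where
  measurable := measurable_bump.comp ((measurable_const_mul ε).sub_const R)
  nonneg _ := bump_nonneg _
  le_two _ := (bump_le_one _).trans one_le_two
  eq_zero_of_neg y hy := by
    have := mul_neg_of_pos_of_neg hε hy
    exact bump_of_one_le_abs (by rw [abs_of_neg] <;> linarith)

/-- One step of the walk tilted by `τ (k + 1)`, seen relative to `c` and acting on functions of the
height. -/
def tiltedStep (P : Measure Ω) (ξ : Ω → ℤ) (c τ : ℕ → ℝ) (G : ℝ → ℝ) (k : ℕ) (y : ℝ) : ℝ :=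
  ∫ ω, G (y + (ξ ω - (c (k + 1) - c k))) ∂P.tilted fun ω => τ (k + 1) * (ξ ω : ℝ)

/-- The cost, to leading exponential order, of following `c` between the times `k` and `m`. -/
def pathCost (P : Measure Ω) (ξ : Ω → ℤ) (c : ℕ → ℝ) (k m : ℕ) : ℝ :=
  ∑ i ∈ Finset.Ico k m, rate (fun ω => (ξ ω : ℝ)) P (c (i + 1) - c i)

/-- The profile `G` of the height above the obstacle at time `k`, with the exponential weight that
turns the killed walk into the walk tilted along `τ`. -/
def weighted (c τ : ℕ → ℝ) (G : ℝ → ℝ) (k : ℕ) (z : ℤ) : ℝ≥0∞ :=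
  ENNReal.ofReal (Real.exp (τ k * (z - c k)) * G (z - c k))

lemma pathCost_eq_add {k m : ℕ} (hkm : k < m) : pathCost P ξ c k m =
    rate (fun ω => (ξ ω : ℝ)) P (c (k + 1) - c k) + pathCost P ξ c (k + 1) m :=
  Finset.sum_eq_sum_Ico_succ_bot hkm _

lemma tiltedStep_nonneg (hG : IsProfile G) (k : ℕ) (y : ℝ) : 0 ≤ tiltedStep P ξ c τ G k y :=
  integral_nonneg fun _ => hG.nonneg _

variable {a b c₁ c₂ A l : ℝ} {n m : ℕ}

lemma exp_pathCost_succ {k : ℕ} (hkm : k < m) :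
    ENNReal.ofReal (Real.exp (-(pathCost P ξ c (k + 1) m + l * (m - (k + 1 : ℕ))))) *
        ENNReal.ofReal (Real.exp (-rate (fun ω => (ξ ω : ℝ)) P (c (k + 1) - c k))) *
        ENNReal.ofReal (Real.exp (-l)) =
      ENNReal.ofReal (Real.exp (-(pathCost P ξ c k m + l * (m - k)))) := by
  rw [← ENNReal.ofReal_mul (by positivity), ← ENNReal.ofReal_mul (by positivity), ← Real.exp_add,
    ← Real.exp_add, pathCost_eq_add hkm]
  push_cast
  ring_nf

variable [IsProbabilityMeasure P]

lemma killedStep_weighted (hξ : Measurable ξ) (hG : IsProfile G) {k : ℕ}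
    (hτ : τ (k + 1) ∈ interior (integrableExpSet (fun ω => (ξ ω : ℝ)) P))
    (hmean : deriv (cgf (fun ω => (ξ ω : ℝ)) P) (τ (k + 1)) = c (k + 1) - c k) (z : ℤ) :
    killedStep P ξ (c (k + 1)) (weighted c τ G (k + 1)) z =
      ENNReal.ofReal (Real.exp (-rate (fun ω => (ξ ω : ℝ)) P (c (k + 1) - c k))) *
        ENNReal.ofReal (Real.exp (τ (k + 1) * (z - c k)) *
          tiltedStep P ξ c τ G k (z - c k)) := by
  have hτ' : τ (k + 1) ∈ integrableExpSet (fun ω => (ξ ω : ℝ)) P := interior_subset hτ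
  have : IsProbabilityMeasure (P.tilted fun ω => τ (k + 1) * (ξ ω : ℝ)) :=
    isProbabilityMeasure_tilted hτ'
  have hYm : Measurable fun ω => (ξ ω : ℝ) := measurable_from_top.comp hξ
  have hGm : Measurable fun ω => G (z - c k + (ξ ω - (c (k + 1) - c k))) :=
    hG.measurable.comp (by fun_prop)
  have hdm : Measurable fun ω => ENNReal.ofReal (Real.exp (τ (k + 1) * (ξ ω : ℝ)) /
      ∫ ω, Real.exp (τ (k + 1) * (ξ ω : ℝ)) ∂P) := by fun_prop
  have hint : Integrable (fun ω => G (z - c k + (ξ ω - (c (k + 1) - c k))))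
      (P.tilted fun ω => τ (k + 1) * (ξ ω : ℝ)) :=
    .of_bound hGm.aestronglyMeasurable 2 (.of_forall fun ω => by
      rw [Real.norm_of_nonneg (hG.nonneg _)]
      exact hG.le_two _)
  rw [tiltedStep, ← hmean, rate_deriv_cgf hτ, hmean, ENNReal.ofReal_mul (Real.exp_pos _).le,
    ofReal_integral_eq_lintegral_ofReal hint (.of_forall fun ω => hG.nonneg _), lintegral_tilted,
    ← lintegral_const_mul _ (hdm.fun_mul hGm.ennreal_ofReal),
    ← lintegral_const_mul _ ((hdm.fun_mul hGm.ennreal_ofReal).const_mul _), killedStep]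
  refine lintegral_congr fun ω => ?_
  have hheight : ((z + ξ ω : ℤ) : ℝ) - c (k + 1) = z - c k + (ξ ω - (c (k + 1) - c k)) := by
    push_cast
    ring
  have hsupp : {w : ℤ | c (k + 1) ≤ w}.indicator (weighted c τ G (k + 1)) =
      weighted c τ G (k + 1) := by
    refine Set.indicator_eq_self.2 fun w hw => ?_
    change c (k + 1) ≤ w
    contrapose! hw
    simp only [weighted, hG.eq_zero_of_neg _ (sub_neg.2 hw), mul_zero, ENNReal.ofReal_zero,
      Function.notMem_support]
  rw [hsupp, weighted, hheight, ← ENNReal.ofReal_mul (by positivity),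
    ← ENNReal.ofReal_mul (by positivity), ← ENNReal.ofReal_mul (by positivity), ← mgf,
    ← exp_cgf hτ', ← Real.exp_sub, ← mul_assoc, ← mul_assoc, ← Real.exp_add, ← Real.exp_add]
  ring_nf

lemma killedIter_weighted_le (hξ : Measurable ξ)
    (hI : Set.Icc a b ⊆ interior (integrableExpSet (fun ω => (ξ ω : ℝ)) P))
    (hτ : TiltSchedule P (fun ω => (ξ ω : ℝ)) a b c₁ c₂ A n c τ) (hG : IsProfile G)
    (hstep : ∀ k < n, ∀ y, 0 ≤ y → Real.exp (τ (k + 1) * y) * tiltedStep P ξ c τ G k y ≤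
      Real.exp (-l) * (Real.exp (τ k * y) * G y)) {z : ℤ} (hz : c 0 ≤ z) :
    killedIter P ξ c 0 n (weighted c τ G n) z ≤
      ENNReal.ofReal (Real.exp (-(pathCost P ξ c 0 n + l * n))) * weighted c τ G 0 z := by
  set g : ℕ → ℤ → ℝ≥0∞ := fun k z =>
    ENNReal.ofReal (Real.exp (-(pathCost P ξ c k n + l * (n - k)))) * weighted c τ G k z
  have hsuper : ∀ k < n, ∀ z : ℤ, c k ≤ z → killedStep P ξ (c (k + 1)) (g (k + 1)) z ≤ g k z := by
    intro k hk z hz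
    simp only [g]
    rw [killedStep_const_mul hξ,
      killedStep_weighted hξ hG (hI (hτ.mem k hk)) (hτ.deriv_eq k hk), ← exp_pathCost_succ hk,
      mul_assoc, mul_assoc]
    gcongr
    rw [weighted, ← ENNReal.ofReal_mul (Real.exp_pos _).le]
    exact ENNReal.ofReal_le_ofReal (hstep k hk _ (sub_nonneg.2 hz))
  have hend : g n = weighted c τ G n := by
    funext w
    simp [g, pathCost]
  have h0 := killedIter_le_of_supersolution hsuper (zero_add n) hz
  rw [hend] at h0
  simpa only [g, Nat.cast_zero, sub_zero] using h0

lemma le_killedIter_weighted (hξ : Measurable ξ)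
    (hI : Set.Icc a b ⊆ interior (integrableExpSet (fun ω => (ξ ω : ℝ)) P))
    (hτ : TiltSchedule P (fun ω => (ξ ω : ℝ)) a b c₁ c₂ A n c τ) (hG : IsProfile G)
    (hstep : ∀ k < n, ∀ y, Real.exp (-l) * (Real.exp (τ k * y) * G y) ≤
      Real.exp (τ (k + 1) * y) * tiltedStep P ξ c τ G k y) {k j : ℕ} (hkj : k + j = m) (hmn : m ≤ n)
    (z : ℤ) :
    ENNReal.ofReal (Real.exp (-(pathCost P ξ c k m + l * j))) * weighted c τ G k z ≤
      killedIter P ξ c k j (weighted c τ G m) z := by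
  set g : ℕ → ℤ → ℝ≥0∞ := fun k z =>
    ENNReal.ofReal (Real.exp (-(pathCost P ξ c k m + l * (m - k)))) * weighted c τ G k z
  have hsub : ∀ i, k ≤ i → i < m → ∀ z : ℤ,
      g i z ≤ killedStep P ξ (c (i + 1)) (g (i + 1)) z := by
    intro i _ him z
    have hi : i < n := him.trans_le hmn
    simp only [g]
    rw [killedStep_const_mul hξ,
      killedStep_weighted hξ hG (hI (hτ.mem i hi)) (hτ.deriv_eq i hi), ← exp_pathCost_succ him,
      mul_assoc, mul_assoc]
    gcongr
    rw [weighted, ← ENNReal.ofReal_mul (Real.exp_pos _).le]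
    exact ENNReal.ofReal_le_ofReal (hstep i hi _)
  have hend : g m = weighted c τ G m := by
    funext w
    simp [g, pathCost]
  have h0 := le_killedIter_of_subsolution hsub hkj z
  rw [hend] at h0
  simpa only [g, ← hkj, Nat.cast_add, add_sub_cancel_left] using h0

/-- A compact interval `[a, b]` of admissible tilts under which the recentred increments satisfy
moment bounds with common constants. -/
structure CentredTilts (P : Measure Ω) (ξ : Ω → ℤ) (a b v M : ℝ) : Prop where
  subset_interior : Set.Icc a b ⊆ interior (integrableExpSet (fun ω => (ξ ω : ℝ)) P)
  centred : ∀ t ∈ Set.Icc a b, Centred (P.tilted fun ω => t * (ξ ω : ℝ))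
    (fun ω => ξ ω - deriv (cgf (fun ω => (ξ ω : ℝ)) P) t) v M

variable {v M r : ℝ}

lemma exp_mul_tiltedStep_satProfile_le (hτ : TiltSchedule P (fun ω => (ξ ω : ℝ)) a b c₁ c₂ A n c τ)
    (hU : CentredTilts P ξ a b v M) (hl : 0 ≤ l) (hlc : 2 * l ≤ c₁) (hlv : 24 * l ≤ v) (hr : 0 < r)
    (hlr : 10 * M * r⁻¹ ≤ l) (hrn : r ^ 3 = n) {k : ℕ} (hk : k < n) {y : ℝ} (hy : 0 ≤ y) :
    Real.exp (τ (k + 1) * y) * tiltedStep P ξ c τ (fun y => satProfile (r⁻¹ * y)) k y ≤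
      Real.exp (-(l * r⁻¹ ^ 2)) * (Real.exp (τ k * y) * satProfile (r⁻¹ * y)) := by
  have hti := interior_subset (hU.subset_interior (hτ.mem k hk))
  have : IsProbabilityMeasure (P.tilted fun ω => τ (k + 1) * (ξ ω : ℝ)) :=
    isProbabilityMeasure_tilted hti
  have hweight : Real.exp (τ (k + 1) * y) ≤
      Real.exp (τ k * y) * Real.exp (-(c₁ * r⁻¹ ^ 2 * (r⁻¹ * y))) := by
    rw [← Real.exp_add, Real.exp_le_exp]
    have hdrop := mul_le_mul_of_nonneg_right (hτ.le_drop k hk) hy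
    have hscale : c₁ / n * y = c₁ * r⁻¹ ^ 2 * (r⁻¹ * y) := by rw [← hrn]; ring
    linarith
  have hprofile := (hU.centred _ (hτ.mem k hk)).exp_mul_integral_satProfile_le hl hlc hlv
    (inv_pos.2 hr).le hlr (mul_nonneg (inv_pos.2 hr).le hy)
  simp only [hτ.deriv_eq k hk, ← mul_add] at hprofile
  calc Real.exp (τ (k + 1) * y) * tiltedStep P ξ c τ (fun y => satProfile (r⁻¹ * y)) k y
      ≤ Real.exp (τ k * y) * Real.exp (-(c₁ * r⁻¹ ^ 2 * (r⁻¹ * y))) *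
          tiltedStep P ξ c τ (fun y => satProfile (r⁻¹ * y)) k y :=
        mul_le_mul_of_nonneg_right hweight
          (tiltedStep_nonneg (isProfile_satProfile (inv_pos.2 hr)) _ _)
    _ ≤ Real.exp (τ k * y) * (Real.exp (-(l * r⁻¹ ^ 2)) * satProfile (r⁻¹ * y)) := by
        rw [mul_assoc]
        exact mul_le_mul_of_nonneg_left hprofile (Real.exp_pos _).le
    _ = Real.exp (-(l * r⁻¹ ^ 2)) * (Real.exp (τ k * y) * satProfile (r⁻¹ * y)) := by ring

lemma exp_mul_bump_le_tiltedStep (hτ : TiltSchedule P (fun ω => (ξ ω : ℝ)) a b c₁ c₂ A n c τ)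
    (hU : CentredTilts P ξ a b v M) (hc₂ : 0 ≤ c₂) {R : ℝ} (hR : 1 ≤ R) (hr : 0 < r)
    (hrv : 6 * M * r⁻¹ ≤ v) (hrM : 24 * (1 + M) * r⁻¹ ^ 2 ≤ 1) (hrn : r ^ 3 = n) {k : ℕ}
    (hk : k < n) (y : ℝ) :
    Real.exp (-((24 * (1 + M) + c₂ * (R + 1)) * r⁻¹ ^ 2)) *
        (Real.exp (τ k * y) * bump (r⁻¹ * y - R)) ≤
      Real.exp (τ (k + 1) * y) * tiltedStep P ξ c τ (fun y => bump (r⁻¹ * y - R)) k y := by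
  have hε := inv_pos.2 hr
  rcases le_or_gt 1 |r⁻¹ * y - R| with hout | hin
  · rw [bump_of_one_le_abs hout, mul_zero, mul_zero]
    exact mul_nonneg (Real.exp_pos _).le (tiltedStep_nonneg (isProfile_bump hε hR) _ _)
  have hti := interior_subset (hU.subset_interior (hτ.mem k hk))
  have : IsProbabilityMeasure (P.tilted fun ω => τ (k + 1) * (ξ ω : ℝ)) :=
    isProbabilityMeasure_tilted hti
  obtain ⟨hlo, hhi⟩ := abs_lt.1 hin
  have hy : 0 ≤ y := nonneg_of_mul_nonneg_right (by linarith) hε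
  have hweight : Real.exp (-(c₂ * (R + 1) * r⁻¹ ^ 2)) * Real.exp (τ k * y) ≤
      Real.exp (τ (k + 1) * y) := by
    rw [← Real.exp_add, Real.exp_le_exp]
    have hdrop := mul_le_mul_of_nonneg_right (hτ.drop_le k hk) hy
    have hscale : c₂ / n * y = c₂ * r⁻¹ ^ 2 * (r⁻¹ * y) := by rw [← hrn]; ring
    have htube : c₂ * r⁻¹ ^ 2 * (r⁻¹ * y) ≤ c₂ * r⁻¹ ^ 2 * (R + 1) := by gcongr; linarith
    linarith
  have hprofile := (hU.centred _ (hτ.mem k hk)).exp_mul_bump_le hε.le hrv hrM (r⁻¹ * y - R)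
  have hshift : ∀ x : ℝ, r⁻¹ * y - R + r⁻¹ * x = r⁻¹ * (y + x) - R := fun x => by ring
  simp only [hτ.deriv_eq k hk, hshift] at hprofile
  calc Real.exp (-((24 * (1 + M) + c₂ * (R + 1)) * r⁻¹ ^ 2)) *
        (Real.exp (τ k * y) * bump (r⁻¹ * y - R))
      = Real.exp (-(c₂ * (R + 1) * r⁻¹ ^ 2)) * Real.exp (τ k * y) *
          (Real.exp (-(24 * (1 + M) * r⁻¹ ^ 2)) * bump (r⁻¹ * y - R)) := by
        rw [add_mul, neg_add, Real.exp_add]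
        ring
    _ ≤ Real.exp (τ (k + 1) * y) * tiltedStep P ξ c τ (fun y => bump (r⁻¹ * y - R)) k y :=
        mul_le_mul hweight hprofile (mul_nonneg (Real.exp_pos _).le (bump_nonneg _))
          (Real.exp_pos _).le

lemma indicator_ceil_le {ε : ℝ} (hε : 0 < ε) {k : ℕ} (hA : |τ k| ≤ A) (z : ℤ) :
    Set.indicator {⌈c k⌉} (1 : ℤ → ℝ≥0∞) z ≤
      ENNReal.ofReal (Real.exp A) * weighted c τ (fun y => satProfile (ε * y)) k z := by
  revert z
  refine Set.indicator_le fun z hz => ?_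
  obtain rfl : z = ⌈c k⌉ := hz
  have hy0 : 0 ≤ (⌈c k⌉ : ℝ) - c k := sub_nonneg.2 (Int.le_ceil _)
  have hy1 : (⌈c k⌉ : ℝ) - c k ≤ 1 := by linarith [Int.ceil_lt_add_one (c k)]
  have hweight : -A ≤ τ k * (⌈c k⌉ - c k) := by
    refine (abs_le.1 ?_).1
    rw [abs_mul, abs_of_nonneg hy0]
    exact (mul_le_of_le_one_right (abs_nonneg _) hy1).trans hA
  rw [weighted, ← ENNReal.ofReal_mul (Real.exp_pos _).le, ← mul_assoc, ← Real.exp_add,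
    Pi.one_apply, ENNReal.one_le_ofReal]
  exact one_le_mul_of_one_le_of_one_le (Real.one_le_exp (by linarith))
    (one_le_satProfile (mul_nonneg hε.le hy0))

lemma killedIter_endpoint_le (hξ : Measurable ξ)
    (hτ : TiltSchedule P (fun ω => (ξ ω : ℝ)) a b c₁ c₂ A n c τ) (hU : CentredTilts P ξ a b v M)
    (hl : 0 ≤ l) (hlc : 2 * l ≤ c₁) (hlv : 24 * l ≤ v) (hr : 0 < r) (hlr : 10 * M * r⁻¹ ≤ l)
    (hrn : r ^ 3 = n) (hc0 : c 0 = 0) :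
    killedIter P ξ c 0 n (Set.indicator {⌈c n⌉} 1) 0 ≤
      ENNReal.ofReal (Real.exp (A - pathCost P ξ c 0 n - l * r)) := by
  have hε := inv_pos.2 hr
  have hiter := killedIter_weighted_le hξ hU.subset_interior hτ (isProfile_satProfile hε)
    (fun k hk y hy => exp_mul_tiltedStep_satProfile_le hτ hU hl hlc hlv hr hlr hrn hk hy)
    (z := 0) (by rw [hc0, Int.cast_zero])
  have hstart : weighted c τ (fun y => satProfile (r⁻¹ * y)) 0 0 = 1 := by
    simp only [weighted, hc0, satProfile_of_nonneg le_rfl, Int.cast_zero, sub_zero, mul_zero,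
      neg_zero, Real.exp_zero]
    norm_num
  have hsteps : l * r⁻¹ ^ 2 * n = l * r := by
    rw [← hrn]
    field_simp
  calc killedIter P ξ c 0 n (Set.indicator {⌈c n⌉} 1) 0
      ≤ ENNReal.ofReal (Real.exp A) *
          killedIter P ξ c 0 n (weighted c τ (fun y => satProfile (r⁻¹ * y)) n) 0 := by
        rw [← killedIter_const_mul hξ]
        exact killedIter_mono (indicator_ceil_le hε (hτ.abs_le n le_rfl)) _ _ _
    _ ≤ ENNReal.ofReal (Real.exp A) *
          ENNReal.ofReal (Real.exp (-(pathCost P ξ c 0 n + l * r⁻¹ ^ 2 * n))) := by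
        rw [hstart, mul_one] at hiter
        gcongr
    _ = ENNReal.ofReal (Real.exp (A - pathCost P ξ c 0 n - l * r)) := by
        rw [← ENNReal.ofReal_mul (Real.exp_pos _).le, ← Real.exp_add, hsteps]
        ring_nf

lemma abs_inv_mul_sub (hr : 0 < r) (y R : ℝ) : |r⁻¹ * y - R| = r⁻¹ * |y - R * r| := by
  rw [← abs_of_pos (inv_pos.2 hr), ← abs_mul, abs_of_pos (inv_pos.2 hr), mul_sub, mul_left_comm,
    inv_mul_cancel₀ hr.ne', mul_one]

lemma abs_mul_le_of_mem_tube {t R y : ℝ} (hR : 0 ≤ R) (hr : 0 < r) (hA : |t| ≤ A)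
    (hy : |y - R * r| ≤ r) : |t * y| ≤ A * ((R + 1) * r) := by
  have hRr : 0 ≤ R * r := by positivity
  rw [abs_mul]
  refine mul_le_mul hA ?_ (abs_nonneg _) ((abs_nonneg _).trans hA)
  rw [abs_le] at hy ⊢
  constructor <;> linarith

lemma le_weighted_bump {R : ℝ} (hR : 0 ≤ R) (hr : 0 < r) {k : ℕ} (hA : |τ k| ≤ A) {z : ℤ}
    (hz : |z - c k - R * r| ≤ 3 / 4 * r) :
    ENNReal.ofReal (Real.exp (-(A * ((R + 1) * r))) / 6) ≤
      weighted c τ (fun y => bump (r⁻¹ * y - R)) k z := by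
  have hweight := (abs_le.1 (abs_mul_le_of_mem_tube hR hr hA (by linarith))).1
  rw [weighted, div_eq_mul_one_div]
  refine ENNReal.ofReal_le_ofReal (mul_le_mul (Real.exp_le_exp.2 hweight) (le_bump_of_abs_le ?_)
    (by norm_num) (Real.exp_pos _).le)
  rw [abs_inv_mul_sub hr, inv_mul_le_iff₀ hr]
  linarith

lemma weighted_bump_le {R : ℝ} (hR : 0 ≤ R) (hr : 0 < r) {k : ℕ} (hA : |τ k| ≤ A) {φ : ℤ → ℝ≥0∞}
    {q : ℝ≥0∞} (hφ : ∀ z : ℤ, |z - c k - R * r| ≤ r → q ≤ φ z) (z : ℤ) :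
    q * ENNReal.ofReal (Real.exp (-(A * ((R + 1) * r)))) *
      weighted c τ (fun y => bump (r⁻¹ * y - R)) k z ≤ φ z := by
  rcases le_or_gt |z - c k - R * r| r with hz | hz
  · have hweight := (abs_le.1 (abs_mul_le_of_mem_tube hR hr hA hz)).2
    rw [weighted, mul_assoc, ← ENNReal.ofReal_mul (Real.exp_pos _).le, ← mul_assoc,
      ← Real.exp_add]
    refine (mul_le_of_le_one_right' (ENNReal.ofReal_le_one.2 ?_)).trans (hφ z hz)
    exact mul_le_one₀ (Real.exp_le_one_iff.2 (by linarith)) (bump_nonneg _) (bump_le_one _)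
  · rw [weighted, bump_of_one_le_abs, mul_zero, ENNReal.ofReal_zero, mul_zero]
    · exact zero_le
    · rw [abs_inv_mul_sub hr, le_inv_mul_iff₀ hr]
      linarith

lemma le_killedIter_tube (hξ : Measurable ξ)
    (hτ : TiltSchedule P (fun ω => (ξ ω : ℝ)) a b c₁ c₂ A n c τ) (hU : CentredTilts P ξ a b v M)
    (hc₂ : 0 ≤ c₂) {R : ℝ} (hR : 1 ≤ R) (hr : 0 < r) (hrv : 6 * M * r⁻¹ ≤ v)
    (hrM : 24 * (1 + M) * r⁻¹ ^ 2 ≤ 1) (hrn : r ^ 3 = n) {k j : ℕ} (hkj : k + j = m)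
    (hmn : m ≤ n) {φ : ℤ → ℝ≥0∞} {q : ℝ≥0∞}
    (hφ : ∀ w : ℤ, |w - c m - R * r| ≤ r → q ≤ φ w) {z : ℤ}
    (hz : |z - c k - R * r| ≤ 3 / 4 * r) :
    ENNReal.ofReal (Real.exp (-(pathCost P ξ c k m + (24 * (1 + M) + c₂ * (R + 1)) * r⁻¹ ^ 2 * j +
      2 * (A * ((R + 1) * r)))) / 6) * q ≤ killedIter P ξ c k j φ z := by
  have hR0 : 0 ≤ R := zero_le_one.trans hR
  have hstart := le_weighted_bump hR0 hr (hτ.abs_le k (by lia)) hz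
  have hiter := le_killedIter_weighted hξ hU.subset_interior hτ (isProfile_bump (inv_pos.2 hr) hR)
    (fun k hk y => exp_mul_bump_le_tiltedStep hτ hU hc₂ hR hr hrv hrM hrn hk y) hkj hmn z
  set S := pathCost P ξ c k m + (24 * (1 + M) + c₂ * (R + 1)) * r⁻¹ ^ 2 * j
  set W := A * ((R + 1) * r)
  have hexp : ENNReal.ofReal (Real.exp (-(S + 2 * W)) / 6) = ENNReal.ofReal (Real.exp (-W)) *
      (ENNReal.ofReal (Real.exp (-S)) * ENNReal.ofReal (Real.exp (-W) / 6)) := by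
    rw [← ENNReal.ofReal_mul (by positivity), ← ENNReal.ofReal_mul (by positivity), ← mul_div_assoc,
      ← mul_div_assoc, ← Real.exp_add, ← Real.exp_add]
    ring_nf
  calc ENNReal.ofReal (Real.exp (-(S + 2 * W)) / 6) * q
      = q * ENNReal.ofReal (Real.exp (-W)) *
          (ENNReal.ofReal (Real.exp (-S)) * ENNReal.ofReal (Real.exp (-W) / 6)) := by
        rw [hexp, mul_comm, mul_assoc]
    _ ≤ q * ENNReal.ofReal (Real.exp (-W)) *
          killedIter P ξ c k j (weighted c τ (fun y => bump (r⁻¹ * y - R)) m) z := by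
        gcongr
        exact (mul_le_mul_right hstart _).trans hiter
    _ ≤ killedIter P ξ c k j φ z := by
        rw [← killedIter_const_mul hξ]
        exact killedIter_mono (weighted_bump_le hR0 hr (hτ.abs_le m hmn) hφ) _ _ _

end Comparison

section Endpoints

variable {Ω : Type*} [MeasurableSpace Ω] {P : Measure Ω} {ξ : Ω → ℤ} {c : ℕ → ℝ} {n : ℕ}
  {d₀ d₁ : ℝ}

lemma exists_first_passage {f : ℕ → ℝ} {x α β : ℝ} (h0 : f 0 ≤ x) (hβ : 0 ≤ β)
    (hf : ∀ k < n, α ≤ f (k + 1) - f k ∧ f (k + 1) - f k ≤ β) (hx : x ≤ f 0 + n * α) :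
    ∃ N ≤ n, x ≤ f N ∧ f N ≤ x + β := by
  have hfar : x ≤ f n := by
    have hsum : n * α ≤ f n - f 0 := by
      rw [← Finset.sum_range_sub f n, ← nsmul_eq_mul]
      simpa using Finset.card_nsmul_le_sum (Finset.range n) (fun k => f (k + 1) - f k) α
        fun k hk => (hf k (Finset.mem_range.1 hk)).1
    linarith
  classical
  have hex : ∃ N, x ≤ f N := ⟨n, hfar⟩
  refine ⟨Nat.find hex, Nat.find_min' hex hfar, Nat.find_spec hex, ?_⟩
  rcases hN : Nat.find hex with _ | N
  · linarith
  · have hlt : N < Nat.find hex := hN ▸ N.lt_succ_self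
    have hbefore : f N < x := not_le.1 (Nat.find_min hex hlt)
    linarith [(hf N (hlt.trans_le (Nat.find_min' hex hfar))).2]

lemma sub_mem_Icc_of_slopes (hc : ∀ k < n, c (k + 1) - c k ∈ Set.Icc d₁ d₀) {k l : ℕ}
    (hkl : k + l ≤ n) : c (k + l) - c k ∈ Set.Icc (l * d₁) (l * d₀) := by
  induction l with
  | zero => simp
  | succ l ih =>
    obtain ⟨hlo, hhi⟩ := ih (by lia)
    obtain ⟨hlo', hhi'⟩ := hc (k + l) (by lia)
    rw [← add_assoc]
    push_cast
    constructor <;> linarith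

lemma exists_exp_le_pow {p : ℝ≥0∞} (hp : 0 < p) :
    ∃ β : ℝ, 0 ≤ β ∧ ∀ (N : ℕ) (x : ℝ), N ≤ x → ENNReal.ofReal (Real.exp (-(β * x))) ≤ p ^ N := by
  obtain ⟨u, hu0, hup⟩ : ∃ u : ℝ, 0 < u ∧ ENNReal.ofReal u ≤ p := by
    obtain ⟨u, _, hup⟩ := ENNReal.lt_iff_exists_real_btwn.1 hp
    exact ⟨u, ENNReal.ofReal_pos.1 hup.1, hup.2.le⟩
  refine ⟨|Real.log u|, abs_nonneg _, fun N x hx => ?_⟩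
  calc ENNReal.ofReal (Real.exp (-(|Real.log u| * x)))
      ≤ ENNReal.ofReal (u ^ N) := by
        rw [← Real.exp_log hu0, ← Real.exp_nat_mul, Real.log_exp]
        gcongr
        nlinarith [neg_abs_le (Real.log u), abs_nonneg (Real.log u)]
    _ ≤ p ^ N := by
        rw [ENNReal.ofReal_pow hu0.le]
        gcongr

lemma pow_mul_le_killedIter_const (hξ : Measurable ξ) {j : ℤ} {k N : ℕ} {z : ℤ}
    (hc : ∀ i, 1 ≤ i → i ≤ N → c (k + i) ≤ z + i * j) (φ : ℤ → ℝ≥0∞) :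
    P {ω | ξ ω = j} ^ N * φ (z + N * j) ≤ killedIter P ξ c k N φ z :=
  pow_mul_le_killedIter hξ (A := {j}) (fun y hy => by rw [Set.mem_singleton_iff.1 hy]; simp)
    (by simp) hc

lemma exists_steps {w x r : ℝ} (hw : 0 < w) (hx : 0 ≤ x) (hr : 1 ≤ r) :
    ∃ s : ℕ, x * r ≤ s * w ∧ s ≤ (x / w + 1) * r := by
  refine ⟨⌈x * r / w⌉₊, (div_le_iff₀ hw).1 (Nat.le_ceil _), ?_⟩
  have hceil := Nat.ceil_lt_add_one (show 0 ≤ x * r / w by positivity)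
  rw [add_mul, div_mul_eq_mul_div]
  linarith

lemma exists_ascent_of_le (hξ : Measurable ξ) {j : ℤ} (hj : d₀ < j) (hd : d₁ ≤ d₀) (hc0 : c 0 = 0)
    (hc : ∀ k < n, c (k + 1) - c k ∈ Set.Icc d₁ d₀) {x : ℝ} (hx : 0 ≤ x)
    (hxn : x ≤ n * (j - d₀)) :
    ∃ N ≤ n, x ≤ N * j - c N ∧ N * j - c N ≤ x + (j - d₁) ∧
      ∀ φ, P {ω | ξ ω = j} ^ N * φ (N * j) ≤ killedIter P ξ c 0 N φ 0 := by
  obtain ⟨N, hN, hlo, hhi⟩ := exists_first_passage (n := n) (f := fun i : ℕ => i * j - c i)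
    (x := x) (α := j - d₀) (β := j - d₁) (by simpa [hc0]) (by linarith)
    (fun k hk => by obtain ⟨h₁, h₀⟩ := hc k hk; push_cast; constructor <;> linarith)
    (by simpa [hc0])
  refine ⟨N, hN, hlo, hhi, fun φ => ?_⟩
  have habove : ∀ i, 1 ≤ i → i ≤ N → c (0 + i) ≤ (0 : ℤ) + i * j := fun i _ hi => by
    have hslope := (sub_mem_Icc_of_slopes hc (k := 0) (l := i) (by lia)).2
    have : (i : ℝ) * d₀ ≤ i * j := by gcongr
    push_cast
    linarith
  simpa using pow_mul_le_killedIter_const (P := P) hξ habove φ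

lemma exists_ascent (hξ : Measurable ξ) {j : ℤ} (hp : 0 < P {ω | ξ ω = j}) (hj : d₀ < j)
    (hd : d₁ ≤ d₀) {R : ℝ} (hR : 0 ≤ R) :
    ∃ B r₀ : ℝ, ∀ r, r₀ ≤ r → ∀ (n : ℕ) (c : ℕ → ℝ), B * r ≤ n → c 0 = 0 →
      (∀ k < n, c (k + 1) - c k ∈ Set.Icc d₁ d₀) →
      ∃ (N : ℕ) (z : ℤ), N ≤ B * r ∧ |z - c N - R * r| ≤ 3 / 4 * r ∧
        ∀ φ, ENNReal.ofReal (Real.exp (-(B * r))) * φ z ≤ killedIter P ξ c 0 N φ 0 := by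
  have hw : 0 < j - d₀ := sub_pos.2 hj
  obtain ⟨β, hβ, hpow⟩ := exists_exp_le_pow hp
  set B := R / (j - d₀) + 1
  refine ⟨(1 + β) * B, max 1 (2 * (j - d₁)), fun r hr n c hn hc0 hc => ?_⟩
  obtain ⟨hr1, hrj⟩ := max_le_iff.1 hr
  obtain ⟨s, hRs, hsB⟩ := exists_steps hw hR hr1
  have hβB : 0 ≤ β * (B * r) := by positivity
  have hsn : s ≤ n := by exact_mod_cast (by linarith : (s : ℝ) ≤ n)
  obtain ⟨N, hN, hlo, hhi, hstep⟩ := exists_ascent_of_le (P := P) hξ hj hd hc0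
    (fun k hk => hc k (hk.trans_le hsn)) (by positivity) hRs
  have hNB : (N : ℝ) ≤ B * r := hsB.trans' (by exact_mod_cast hN)
  refine ⟨N, N * j, by linarith, ?_, fun φ => le_trans ?_ (hstep φ)⟩
  · push_cast
    rw [abs_le]
    constructor <;> linarith
  · gcongr
    exact (ENNReal.ofReal_le_ofReal (Real.exp_le_exp.2 (by linarith))).trans (hpow N _ hNB)

lemma exists_descent_of_le (hξ : Measurable ξ) {j : ℤ} (hj : j < d₁) (hd : d₁ ≤ d₀) {A : Set ℤ}
    {q : ℝ≥0∞} {C : ℝ} (hC : 0 ≤ C) (hA : ∀ y ∈ A, q ≤ P {ω | ξ ω = y} ∧ -C ≤ y)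
    (hjq : q ≤ P {ω | ξ ω = j}) {m s T : ℕ} (hsm : s ≤ m)
    (hc : ∀ k < m + T, c (k + 1) - c k ∈ Set.Icc d₁ d₀) {x r : ℝ} (hr : 0 ≤ r)
    (hTx : T * (C + |d₀|) ≤ x - r) (hxs : x ≤ T * d₁ + s * (d₁ - j))
    (hT : ∀ D : ℤ, |(D : ℝ)| ≤ r + (d₀ - j) + 1 → D ∈ T • A) :
    ∃ k N, k + N = m ∧ N ≤ s ∧ ∀ φ (z : ℤ), |z - c k - x| ≤ r →
      q ^ (T + N) * φ ⌈c (m + T)⌉ ≤ killedIter P ξ c k (T + N) φ z := by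
  have hslope : ∀ i : ℕ, i ≤ T → i * C + i * d₀ ≤ x - r := fun i hi => by
    have : i * (C + |d₀|) ≤ T * (C + |d₀|) := by gcongr
    have : i * d₀ ≤ i * |d₀| := by gcongr; exact le_abs_self d₀
    linarith
  obtain ⟨hlo₀, hhi₀⟩ := sub_mem_Icc_of_slopes hc (k := m) le_rfl
  have hTC : 0 ≤ T * C := by positivity
  obtain ⟨N, hN, hlo, hhi⟩ := exists_first_passage (n := s) (x := x) (α := d₁ - j) (β := d₀ - j)
    (f := fun N : ℕ => c (m + T) - c (m - N) - N * j)
    (by simp only [Nat.sub_zero, Nat.cast_zero]; linarith [hslope T le_rfl]) (by linarith)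
    (fun N hN => by
      have := hc (m - (N + 1)) (by lia)
      rw [show m - (N + 1) + 1 = m - N by lia] at this
      push_cast
      constructor <;> linarith [this.1, this.2])
    (by simp only [Nat.sub_zero, Nat.cast_zero]; linarith)
  refine ⟨m - N, N, by lia, hN, fun φ z hz => ?_⟩
  obtain ⟨hz₁, hz₂⟩ := abs_le.1 hz
  have hceil := Int.le_ceil (c (m + T))
  have hceil' := Int.ceil_lt_add_one (c (m + T))
  obtain ⟨D, hD⟩ : ∃ D : ℤ, z + D + N * j = ⌈c (m + T)⌉ := ⟨⌈c (m + T)⌉ - N * j - z, by ring⟩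
  have hDr : (z : ℝ) + D + N * j = ⌈c (m + T)⌉ := by exact_mod_cast hD
  have hlast : q ^ N * φ ⌈c (m + T)⌉ ≤ killedIter P ξ c (m - N + T) N φ (z + D) := by
    rw [← hD]
    refine le_trans (by gcongr) (pow_mul_le_killedIter_const hξ (fun i _ hi => ?_) φ)
    have hend := (sub_mem_Icc_of_slopes hc (k := m - N + T + i) (l := N - i) (by lia)).1
    rw [show m - N + T + i + (N - i) = m + T by lia, Nat.cast_sub hi] at hend
    have hNi : (0 : ℝ) ≤ N - i := sub_nonneg.2 (by exact_mod_cast hi)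
    push_cast
    linarith [mul_le_mul_of_nonneg_left hj.le hNi]
  rw [killedIter_add, pow_add, mul_assoc]
  refine (mul_le_mul_right hlast _).trans (pow_mul_le_killedIter hξ hA (hT D ?_) fun i _ hi => ?_)
  · rw [abs_le]
    constructor <;> linarith
  · have hrise := (sub_mem_Icc_of_slopes hc (k := m - N) (l := i) (by lia)).2
    linarith [hslope i hi]

lemma exists_descent (hξ : Measurable ξ) {j : ℤ} (hj : j < d₁) (hd : d₁ ≤ d₀) {A : Set ℤ}
    {q : ℝ≥0∞} (hq : 0 < q) {C : ℝ} (hC : 0 ≤ C) (hA : ∀ y ∈ A, q ≤ P {ω | ξ ω = y} ∧ -C ≤ y)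
    (hjq : q ≤ P {ω | ξ ω = j}) {K : ℕ} (hK : ∀ (G : ℕ) (D : ℤ), |D| ≤ G → D ∈ (G * K) • A) :
    ∃ R B r₀ : ℝ, 1 ≤ R ∧ ∀ r, r₀ ≤ r → ∀ (n : ℕ) (c : ℕ → ℝ), B * r ≤ n →
      (∀ k < n, c (k + 1) - c k ∈ Set.Icc d₁ d₀) →
      ∃ k M : ℕ, k + M = n ∧ M ≤ B * r ∧ ∀ φ (z : ℤ), |z - c k - R * r| ≤ r →
        ENNReal.ofReal (Real.exp (-(B * r))) * φ ⌈c n⌉ ≤ killedIter P ξ c k M φ z := by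
  have hw : 0 < d₁ - j := sub_pos.2 hj
  obtain ⟨β, hβ, hpow⟩ := exists_exp_le_pow hq
  set R := 1 + 2 * K * (C + |d₀|)
  have hR : 1 ≤ R := le_add_of_nonneg_right (by positivity)
  set B := 2 * K + ((R + 2 * K * |d₁|) / (d₁ - j) + 1) with hB
  refine ⟨R, (1 + β) * B, max 1 (d₀ - j + 2), hR, fun r hr n c hn hc => ?_⟩
  obtain ⟨hr1, hrj⟩ := max_le_iff.1 hr
  have hβB : 0 ≤ β * (B * r) := by positivity
  obtain ⟨s, hxs, hsB⟩ := exists_steps hw (show 0 ≤ R + 2 * K * |d₁| by positivity) hr1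
  set G := ⌈r + (d₀ - j) + 1⌉₊
  have hG : r + (d₀ - j) + 1 ≤ G := Nat.le_ceil _
  have hT : ((G * K : ℕ) : ℝ) ≤ 2 * K * r := by
    have hGr := Nat.ceil_lt_add_one (show 0 ≤ r + (d₀ - j) + 1 by linarith)
    have hG2 : (G : ℝ) ≤ 2 * r := by linarith
    push_cast
    linarith [mul_le_mul_of_nonneg_right hG2 K.cast_nonneg]
  have hsT : s + ((G * K : ℕ) : ℝ) ≤ B * r := by rw [hB, add_mul]; linarith
  have hsTn : s + G * K ≤ n := by exact_mod_cast (by linarith : (s + (G * K : ℕ) : ℝ) ≤ n)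
  obtain ⟨m, rfl⟩ := Nat.exists_eq_add_of_le' (le_of_add_le_right hsTn)
  obtain ⟨k, N, hkN, hN, hstep⟩ := exists_descent_of_le (x := R * r) (r := r) hξ hj hd hC
    hA hjq (le_of_add_le_add_right hsTn) hc (by linarith)
    (by linarith [mul_le_mul_of_nonneg_right hT (show 0 ≤ C + |d₀| by positivity)])
    (by nlinarith [mul_le_mul_of_nonneg_right hT (abs_nonneg d₁), neg_abs_le d₁])
    (fun D hD => hK G D (by exact_mod_cast hD.trans hG))
  have hNB : ((G * K + N : ℕ) : ℝ) ≤ B * r := by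
    refine hsT.trans' ?_
    exact_mod_cast (by lia : G * K + N ≤ s + G * K)
  refine ⟨k, G * K + N, by lia, by linarith, fun φ z hz => le_trans ?_ (hstep φ z hz)⟩
  gcongr
  exact (ENNReal.ofReal_le_ofReal (Real.exp_le_exp.2 (by linarith))).trans (hpow _ _ hNB)

lemma pathCost_sub_le {Λ : ℝ} (hΛ : ∀ i < n, -Λ ≤ rate (fun ω => (ξ ω : ℝ)) P (c (i + 1) - c i))
    {k l m : ℕ} (hn : k + l + m = n) :
    pathCost P ξ c k (k + l) - Λ * (k + m) ≤ pathCost P ξ c 0 n := by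
  have hbound : ∀ i j, i + j ≤ n → -Λ * j ≤ pathCost P ξ c i (i + j) := fun i j hij => by
    simpa [pathCost, mul_comm] using Finset.card_nsmul_le_sum (Finset.Ico i (i + j)) _ (-Λ)
      fun p hp => hΛ p ((Finset.mem_Ico.1 hp).2.trans_le hij)
  have hsplit : pathCost P ξ c 0 n = pathCost P ξ c 0 (0 + k) + pathCost P ξ c k (k + l) +
      pathCost P ξ c (k + l) (k + l + m) := by
    simp only [pathCost, zero_add]
    rw [Finset.sum_Ico_consecutive _ k.zero_le (by lia),
      Finset.sum_Ico_consecutive _ (k + l).zero_le (by lia), hn]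
  linarith [hbound 0 k (by lia), hbound (k + l) m hn.le]

lemma exp_le_killedIter_of_stages {N l m : ℕ} {x y z : ℤ} {p : ℤ → Prop}
    {α β γ : ℝ}
    (h₁ : ∀ φ, ENNReal.ofReal (Real.exp (-α)) * φ y ≤ killedIter P ξ c 0 N φ x)
    (h₂ : ∀ φ q, (∀ w, p w → q ≤ φ w) →
      ENNReal.ofReal (Real.exp (-β)) * q ≤ killedIter P ξ c N l φ y)
    (h₃ : ∀ φ w, p w → ENNReal.ofReal (Real.exp (-γ)) * φ z ≤ killedIter P ξ c (N + l) m φ w) :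
    ENNReal.ofReal (Real.exp (-(α + β + γ))) ≤
      killedIter P ξ c 0 (N + l + m) (Set.indicator {z} 1) x := by
  have hγ : ∀ w, p w → ENNReal.ofReal (Real.exp (-γ)) ≤
      killedIter P ξ c (N + l) m (Set.indicator {z} 1) w := fun w hw => by
    simpa using h₃ (Set.indicator {z} 1) w hw
  rw [neg_add, neg_add, Real.exp_add, Real.exp_add, ENNReal.ofReal_mul (by positivity),
    ENNReal.ofReal_mul (by positivity), add_assoc, killedIter_add, killedIter_add, zero_add,
    mul_assoc]
  exact (mul_le_mul_right (h₂ _ _ hγ) _).trans (h₁ _)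

variable {a b c₂ v M : ℝ} [IsProbabilityMeasure P]

lemma exists_tube (hξ : Measurable ξ) (hU : CentredTilts P ξ a b v M) (hv : 0 < v) (hM : 0 ≤ M)
    (hc₂ : 0 ≤ c₂) {R : ℝ} (hR : 1 ≤ R) (c₁ A : ℝ) :
    ∃ W r₀ : ℝ, ∀ r, r₀ ≤ r → ∀ (n : ℕ) (c τ : ℕ → ℝ),
      TiltSchedule P (fun ω => (ξ ω : ℝ)) a b c₁ c₂ A n c τ → r ^ 3 = n → ∀ k j, k + j ≤ n →
      ∀ (z : ℤ), |z - c k - R * r| ≤ 3 / 4 * r → ∀ (φ : ℤ → ℝ≥0∞) (q : ℝ≥0∞),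
      (∀ w : ℤ, |w - c (k + j) - R * r| ≤ r → q ≤ φ w) →
      ENNReal.ofReal (Real.exp (-(pathCost P ξ c k (k + j) + W * r))) * q ≤
        killedIter P ξ c k j φ z := by
  set E := 24 * (1 + M) + c₂ * (R + 1)
  refine ⟨E + 2 * A * (R + 1) + 2, max 1 (max (6 * M / v) (24 * (1 + M))),
    fun r hr n c τ hτ hrn k j hkj z hz φ q hφ => ?_⟩
  obtain ⟨hr1, hrv, hrM⟩ : 1 ≤ r ∧ 6 * M / v ≤ r ∧ 24 * (1 + M) ≤ r := by
    simpa only [max_le_iff] using hr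
  have hr0 : 0 < r := one_pos.trans_le hr1
  refine le_trans ?_ (le_killedIter_tube hξ hτ hU hc₂ hR hr0 ?_ ?_ hrn rfl hkj hφ hz)
  · have hj : r⁻¹ ^ 2 * j ≤ r := by
      rw [inv_pow, inv_mul_le_iff₀ (by positivity), ← pow_succ, hrn]
      exact_mod_cast (by lia : j ≤ n)
    have hEj : E * (r⁻¹ ^ 2 * j) ≤ E * r := by
      gcongr
    have hsix : Real.exp (-(2 * r)) ≤ 1 / 6 := by
      rw [Real.exp_neg, ← one_div]
      gcongr
      rw [two_mul, Real.exp_add]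
      nlinarith [Real.exp_one_gt_d9, Real.exp_le_exp.2 hr1]
    gcongr
    rw [div_eq_mul_one_div]
    calc Real.exp (-(pathCost P ξ c k (k + j) + (E + 2 * A * (R + 1) + 2) * r))
        = Real.exp (-(pathCost P ξ c k (k + j) + E * r + 2 * (A * ((R + 1) * r)))) *
            Real.exp (-(2 * r)) := by rw [← Real.exp_add]; ring_nf
      _ ≤ _ := by
        refine mul_le_mul (Real.exp_le_exp.2 ?_) hsix (Real.exp_pos _).le (Real.exp_pos _).le
        linarith
  · rwa [← div_eq_mul_inv, div_le_iff₀ hr0, ← div_le_iff₀' hv]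
  · rw [inv_pow, ← div_eq_mul_inv, div_le_one (by positivity)]
    nlinarith

lemma exists_exp_le_killedIter_endpoint (hξ : Measurable ξ) (hab : a ≤ b)
    (hnd : ∀ c : ℝ, ¬ ∀ᵐ ω ∂P, (ξ ω : ℝ) = c) (hU : CentredTilts P ξ a b v M) (hv : 0 < v)
    (hc₂ : 0 ≤ c₂) (c₁ A : ℝ) {B : Set ℤ} {q C : ℝ} (hq : 0 < q) (hC : 0 ≤ C)
    (hB : ∀ y ∈ B, ENNReal.ofReal q ≤ P {ω | ξ ω = y} ∧ -C ≤ y) {K : ℕ}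
    (hK : ∀ (G : ℕ) (D : ℤ), |D| ≤ G → D ∈ (G * K) • B) :
    ∃ D r₀ : ℝ, ∀ r, r₀ ≤ r → ∀ (n : ℕ) (c τ : ℕ → ℝ),
      TiltSchedule P (fun ω => (ξ ω : ℝ)) a b c₁ c₂ A n c τ → r ^ 3 = n → c 0 = 0 →
      ENNReal.ofReal (Real.exp (-(pathCost P ξ c 0 n + D * r))) ≤
        killedIter P ξ c 0 n (Set.indicator {⌈c n⌉} 1) 0 := by
  have haI := hU.subset_interior (Set.left_mem_Icc.2 hab)
  have hM := (hU.centred a (Set.left_mem_Icc.2 hab)).nonneg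
  have hbI := hU.subset_interior (Set.right_mem_Icc.2 hab)
  have hd := monotoneOn_deriv_cgf haI hbI hab
  obtain ⟨Λ, hΛ⟩ := exists_abs_rate_deriv_cgf_le hU.subset_interior
  have hΛ0 : 0 ≤ Λ := (abs_nonneg _).trans (hΛ a (Set.left_mem_Icc.2 hab))
  obtain ⟨i, hi, hdi⟩ := exists_mem_atoms_gt hbI hnd
  obtain ⟨j, hj, hjd⟩ := exists_mem_atoms_lt haI hnd
  obtain ⟨R, F, r₁, hR, hdown⟩ := exists_descent hξ hjd hd
    (lt_min (ENNReal.ofReal_pos.2 hq) hj) hC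
    (fun y hy => ⟨(min_le_left _ _).trans (hB y hy).1, (hB y hy).2⟩) (min_le_right _ _) hK
  obtain ⟨E, r₂, hup⟩ := exists_ascent hξ hi hdi hd (zero_le_one.trans hR)
  obtain ⟨W, r₃, htube⟩ := exists_tube hξ hU hv hM hc₂ hR c₁ A
  refine ⟨E + W + F + Λ * (E + F), max (max r₁ r₂) (max r₃ (max 1 (|E| + |F|))),
    fun r hr n c τ hτ hrn hc0 => ?_⟩
  simp only [max_le_iff] at hr
  obtain ⟨⟨hr₁, hr₂⟩, hr₃, hr1, hEF⟩ := hr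
  have hslope := fun k hk => hτ.sub_mem_Icc hU.subset_interior (k := k) hk
  have hn : |E| * r + |F| * r ≤ n := by
    rw [← hrn, ← add_mul]
    nlinarith [mul_le_mul_of_nonneg_right hEF (zero_le_one.trans hr1)]
  have hEr : E * r ≤ |E| * r := by gcongr; exact le_abs_self E
  have hFr : F * r ≤ |F| * r := by gcongr; exact le_abs_self F
  have hEr0 : 0 ≤ |E| * r := by positivity
  have hFr0 : 0 ≤ |F| * r := by positivity
  obtain ⟨N, z, hN, hz, hfirst⟩ := hup r hr₂ n c (by linarith) hc0 hslope
  obtain ⟨k, m, rfl, hm, hlast⟩ := hdown r hr₁ n c (by linarith) hslope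
  obtain ⟨l, rfl⟩ : ∃ l, k = N + l := Nat.exists_eq_add_of_le <| by
    push_cast at hn
    exact_mod_cast (by linarith : (N : ℝ) ≤ k)
  have hcost := pathCost_sub_le (P := P) (ξ := ξ) (c := c) (n := N + l + m) (Λ := Λ)
    (fun i hi => by rw [← hτ.deriv_eq i hi]; exact (abs_le.1 (hΛ _ (hτ.mem i hi))).1) rfl
  have hNm : Λ * (N + m) ≤ Λ * (E + F) * r := by
    rw [mul_assoc]; gcongr; linarith
  refine le_trans (ENNReal.ofReal_le_ofReal (Real.exp_le_exp.2 ?_))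
    (exp_le_killedIter_of_stages hfirst
      (fun φ q => htube r hr₃ _ c τ hτ hrn N l (by lia) z hz φ q) fun φ w => hlast φ w)
  linarith

end Endpoints

section Estimates

open Filter

lemma exists_exp_cbrt_bounds {p S T : ℕ → ℝ} {K D A l : ℝ} (hl : 0 < l)
    (hST : ∀ n, 0 < n → |S n - T n| ≤ K)
    (hp : ∀ᶠ r : ℝ in atTop, ∀ n : ℕ, r ^ 3 = n →
      Real.exp (-(S n + D * r)) ≤ p n ∧ p n ≤ Real.exp (A - S n - l * r)) :
    ∃ (cp cm : ℝ) (n₀ : ℕ), cm ≤ cp ∧ 0 < cm ∧ 1 ≤ n₀ ∧ ∀ n : ℕ, n₀ ≤ n →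
      Real.exp (-cp * (n : ℝ) ^ (1 / 3 : ℝ)) ≤ Real.exp (T n) * p n ∧
      Real.exp (T n) * p n ≤ Real.exp (-cm * (n : ℝ) ^ (1 / 3 : ℝ)) := by
  have hK : 0 ≤ K := (abs_nonneg _).trans (hST 1 one_pos)
  have hlim : Tendsto (fun n : ℕ => (n : ℝ) ^ (1 / 3 : ℝ)) atTop atTop :=
    (tendsto_rpow_atTop (by norm_num)).comp tendsto_natCast_atTop_atTop
  obtain ⟨n₀, hn₀⟩ := eventually_atTop.1 ((hlim.eventually hp).and
    (hlim.eventually_ge_atTop (max 1 (2 * (A + K) / l))))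
  refine ⟨K + |D| + l, l / 2, max 1 n₀, by linarith [abs_nonneg D], half_pos hl,
    le_max_left _ _, fun n hn => ?_⟩
  obtain ⟨hpn, hr⟩ := hn₀ n ((le_max_right _ _).trans hn)
  have hrn : ((n : ℝ) ^ (1 / 3 : ℝ)) ^ 3 = n := by
    rw [← Real.rpow_natCast, ← Real.rpow_mul n.cast_nonneg]
    norm_num
  obtain ⟨hlower, hupper⟩ := hpn n hrn
  set r := (n : ℝ) ^ (1 / 3 : ℝ)
  obtain ⟨hr1, hrl⟩ := max_le_iff.1 hr
  rw [div_le_iff₀ hl] at hrl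
  obtain ⟨hST₁, hST₂⟩ := abs_le.1 (hST n ((le_max_left _ _).trans hn))
  constructor
  · refine le_trans ?_ (mul_le_mul_of_nonneg_left hlower (Real.exp_pos _).le)
    rw [← Real.exp_add, Real.exp_le_exp]
    have hDr : D * r ≤ |D| * r := by gcongr; exact le_abs_self D
    have hKr : K ≤ K * r := le_mul_of_one_le_right hK hr1
    have hlr : 0 ≤ l * r := by positivity
    linarith
  · refine (mul_le_mul_of_nonneg_left hupper (Real.exp_pos _).le).trans ?_
    rw [← Real.exp_add, Real.exp_le_exp]
    linarith

variable {Ω : Type*} [MeasurableSpace Ω] {P : Measure Ω} {X : ℕ → Ω → ℤ} {Y : Ω → ℝ} {ξ : Ω → ℤ}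
  {h : ℝ → ℝ} {a b : ℝ} {n : ℕ}

lemma not_ae_eq_const_of_isIrreducibleWalk (hident : ∀ i, IdentDistrib (X i) (X 0) P P)
    (hirr : IsIrreducibleWalk X P) (c : ℝ) : ¬ ∀ᵐ ω ∂P, (X 0 ω : ℝ) = c := by
  intro hc
  have hwalk : ∀ᵐ ω ∂P, ∀ k, (walk X k ω : ℝ) = k * c := by
    have hall : ∀ᵐ ω ∂P, ∀ i, (X i ω : ℝ) = c := ae_all_iff.2 fun i =>
      (hident i).symm.ae_snd (p := fun x : ℤ => (x : ℝ) = c) .of_discrete hc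
    filter_upwards [hall] with ω hω k
    simp [walk, hω]
  have hreach : ∀ x : ℤ, ∃ k : ℕ, (x : ℝ) = k * c := fun x => by
    obtain ⟨k, hk⟩ := hirr x
    obtain ⟨ω, hx, hω⟩ := ((frequently_ae_iff.2 hk.ne').and_eventually hwalk).exists
    exact ⟨k, hx ▸ hω k⟩
  obtain ⟨k, hk⟩ := hreach 1
  obtain ⟨l, hl⟩ := hreach (-1)
  push_cast at hk hl
  rcases le_total 0 c with h0 | h0
  · linarith [mul_nonneg l.cast_nonneg h0]
  · linarith [mul_nonpos_of_nonneg_of_nonpos k.cast_nonneg h0]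

lemma exists_lipschitzOnWith_rate_unitDeriv (hC2 : ContDiffOn ℝ 2 h (Set.Icc 0 1))
    (hI : Set.Icc a b ⊆ interior (integrableExpSet Y P))
    (hslope : ∀ s ∈ Set.Icc (0 : ℝ) 1, unitDeriv h s ∈ deriv (cgf Y P) '' Set.Icc a b) :
    ∃ K, LipschitzOnWith K (fun s => rate Y P (unitDeriv h s)) (Set.Icc 0 1) := by
  obtain ⟨L, hL⟩ := (contDiffOn_unitDeriv hC2).exists_lipschitzOnWith one_ne_zero
    (convex_Icc 0 1) isCompact_Icc
  exact ⟨_, (lipschitzOnWith_rate hI).comp hL hslope⟩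

lemma abs_pathCost_obstacle_sub_le {K : NNReal}
    (hJ : LipschitzOnWith K (fun s => rate (fun ω => (ξ ω : ℝ)) P (unitDeriv h s)) (Set.Icc 0 1))
    (hd : DifferentiableOn ℝ h (Set.Icc 0 1)) (hn : 0 < n) :
    |pathCost P ξ (obstacle h n) 0 n -
      n * ∫ s in (0 : ℝ)..1, rate (fun ω => (ξ ω : ℝ)) P (unitDeriv h s)| ≤ K := by
  choose! p hp hslope using fun k (hk : k < n) => exists_unitDeriv_eq_obstacle_sub hd hk
  rw [pathCost, ← Finset.range_eq_Ico,
    Finset.sum_congr rfl fun k hk => by rw [hslope k (Finset.mem_range.1 hk)]]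
  exact abs_riemannSum_sub_le hJ hn hp

variable [IsProbabilityMeasure P]

lemma exists_tiltSchedule_obstacle (hab : a ≤ b)
    (hI : Set.Icc a b ⊆ interior (integrableExpSet Y P)) (hY : ∀ c : ℝ, ¬ ∀ᵐ ω ∂P, Y ω = c)
    (hC2 : ContDiffOn ℝ 2 h (Set.Icc 0 1))
    (hneg : ∀ s ∈ Set.Icc (0 : ℝ) 1, unitDeriv (unitDeriv h) s < 0)
    (hslope : ∀ s ∈ Set.Icc (0 : ℝ) 1, unitDeriv h s ∈ deriv (cgf Y P) '' Set.Icc a b) :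
    ∃ c₁ c₂ A : ℝ, 0 < c₁ ∧ 0 < c₂ ∧ ∀ n, 0 < n →
      ∃ τ, TiltSchedule P Y a b c₁ c₂ A n (obstacle h n) τ := by
  have hd : DifferentiableOn ℝ h (Set.Icc 0 1) := hC2.differentiableOn two_ne_zero
  obtain ⟨m, L, hm, -, hbd⟩ := exists_bilipschitz_unitDeriv hC2 hneg
  obtain ⟨c₁, c₂, A, hc₁, hc₂, hτ⟩ := exists_tiltSchedule hab hI hY hm L
  refine ⟨c₁, c₂, A, hc₁, hc₂, fun n hn => hτ n hn _ (fun k hk => ?_) fun k hk => ?_⟩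
  · obtain ⟨s, hs, hks⟩ := exists_unitDeriv_eq_obstacle_sub hd hk
    exact hks ▸ hslope s (Icc_div_subset_unit hk hs)
  · obtain ⟨s, hs0, hs1, hks⟩ := exists_unitDeriv_sub_eq_obstacle_sub_sub hd hk
    have hn' : (0 : ℝ) ≤ (n : ℝ)⁻¹ := by positivity
    rw [hks]
    simpa [div_eq_mul_inv] using hbd s ⟨hs0, by linarith⟩ (s + (n : ℝ)⁻¹) ⟨by linarith, hs1⟩
      (le_add_of_nonneg_right hn')

lemma exists_exp_le_measureReal_aboveEvent_le (hmeas : ∀ i, Measurable (X i))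
    (hindep : iIndepFun X P) (hident : ∀ i, IdentDistrib (X i) (X 0) P P)
    (hirr : IsIrreducibleWalk X P) (haper : IsAperiodicWalk X P) (hab : a ≤ b)
    (hI : Set.Icc a b ⊆ interior (integrableExpSet (fun ω => (X 0 ω : ℝ)) P))
    (hC2 : ContDiffOn ℝ 2 h (Set.Icc 0 1))
    (hneg : ∀ s ∈ Set.Icc (0 : ℝ) 1, unitDeriv (unitDeriv h) s < 0)
    (hslope : ∀ s ∈ Set.Icc (0 : ℝ) 1,
      unitDeriv h s ∈ deriv (cgf (fun ω => (X 0 ω : ℝ)) P) '' Set.Icc a b)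
    (h0 : h 0 = 0) :
    ∃ D A l : ℝ, 0 < l ∧ ∀ᶠ r : ℝ in atTop, ∀ n : ℕ, r ^ 3 = n →
      Real.exp (-(pathCost P (X 0) (obstacle h n) 0 n + D * r)) ≤ P.real (aboveEvent X h n) ∧
      P.real (aboveEvent X h n) ≤
        Real.exp (A - pathCost P (X 0) (obstacle h n) 0 n - l * r) := by
  have hnd := not_ae_eq_const_of_isIrreducibleWalk hident hirr
  obtain ⟨c₁, c₂, A, hc₁, hc₂, hτ⟩ := exists_tiltSchedule_obstacle hab hI hnd hC2 hneg hslope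
  obtain ⟨v, M, hv, hcent⟩ := exists_centred_tilted (hmeas 0) hab hI hnd
  have hU : CentredTilts P (X 0) a b v M := ⟨hI, hcent⟩
  obtain ⟨K, B, C, q, hC, hq, hB, hK⟩ := exists_uniform_blocks hident hirr haper
  obtain ⟨D, r₀, hlower⟩ := exists_exp_le_killedIter_endpoint (hmeas 0) hab hnd hU hv hc₂.le c₁ A
    hq hC hB hK
  obtain ⟨l, hl, hlc, hlv⟩ : ∃ l, 0 < l ∧ 2 * l ≤ c₁ ∧ 24 * l ≤ v :=
    ⟨min (c₁ / 2) (v / 24), by positivity, by linarith [min_le_left (c₁ / 2) (v / 24)],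
      by linarith [min_le_right (c₁ / 2) (v / 24)]⟩
  refine ⟨D, A, l, hl, ?_⟩
  filter_upwards [eventually_ge_atTop r₀, eventually_ge_atTop (10 * M / l), eventually_gt_atTop 0]
    with r hr₀ hrl hr n hrn
  obtain ⟨τ, hτn⟩ := hτ n (by exact_mod_cast hrn ▸ pow_pos hr 3)
  have hc0 : obstacle h n 0 = 0 := by simp [obstacle, h0]
  have hlr : 10 * M * r⁻¹ ≤ l := by
    rwa [← div_eq_mul_inv, div_le_comm₀ hr hl]
  rw [Measure.real, measure_aboveEvent hmeas hindep hident h0]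
  have hupper := killedIter_endpoint_le (hmeas 0) hτn hU hl.le hlc hlv hr hlr hrn hc0
  exact ⟨(ENNReal.ofReal_le_iff_le_toReal (hupper.trans_lt ENNReal.ofReal_lt_top).ne).1
      (hlower r hr₀ n _ τ hτn hrn hc0),
    ENNReal.toReal_le_of_le_ofReal (Real.exp_pos _).le hupper⟩

end Estimates

end ObstacleWalk

end

open ObstacleWalk

theorem theorem1_general {Ω : Type*} [MeasurableSpace Ω] (P : Measure Ω) [IsProbabilityMeasure P]
    (X : ℕ → Ω → ℤ) (hmeas : ∀ i, Measurable (X i)) (hindep : iIndepFun X P)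
    (hident : ∀ i, IdentDistrib (X i) (X 0) P P)
    (hirr : IsIrreducibleWalk X P) (haper : IsAperiodicWalk X P)
    (Y : Ω → ℝ) (hY : Y = fun ω => (X 0 ω : ℝ))
    (a b : ℝ) (ha : lowerTilt Y P < (a : EReal)) (hb : (b : EReal) < upperTilt Y P)
    (h : ℝ → ℝ) (hC2 : ContDiffOn ℝ 2 h (Set.Icc 0 1))
    (hneg : ∀ s ∈ Set.Icc (0 : ℝ) 1, unitDeriv (unitDeriv h) s < 0)
    (hslope : ∀ s ∈ Set.Icc (0 : ℝ) 1, unitDeriv h s ∈ deriv (cgf Y P) '' Set.Icc a b)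
    (h0 : h 0 = 0) :
    (∀ s ∈ Set.Icc (0 : ℝ) 1, BddAbove (legendreValues Y P (unitDeriv h s))) ∧
    IntervalIntegrable (fun s => rate Y P (unitDeriv h s)) volume 0 1 ∧
    ∃ (cp cm : ℝ) (n₀ : ℕ), cm ≤ cp ∧ 0 < cm ∧ 1 ≤ n₀ ∧ ∀ n : ℕ, n₀ ≤ n →
      Real.exp (-cp * (n : ℝ) ^ (1 / 3 : ℝ)) ≤
        Real.exp ((n : ℝ) * ∫ s in (0 : ℝ)..1, rate Y P (unitDeriv h s)) *
          P.real (aboveEvent X h n) ∧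
      Real.exp ((n : ℝ) * ∫ s in (0 : ℝ)..1, rate Y P (unitDeriv h s)) *
          P.real (aboveEvent X h n) ≤
        Real.exp (-cm * (n : ℝ) ^ (1 / 3 : ℝ)) := by
  subst hY
  have hI := Icc_subset_interior_integrableExpSet ha hb
  obtain ⟨t, ht, -⟩ := hslope 0 (Set.left_mem_Icc.2 zero_le_one)
  obtain ⟨K, hJ⟩ := exists_lipschitzOnWith_rate_unitDeriv hC2 hI hslope
  obtain ⟨D, A, l, hl, hP⟩ := exists_exp_le_measureReal_aboveEvent_le hmeas hindep hident hirr
    haper (ht.1.trans ht.2) hI hC2 hneg hslope h0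
  refine ⟨fun s hs => ?_, hJ.continuousOn.intervalIntegrable_of_Icc zero_le_one, ?_⟩
  · obtain ⟨t, ht, hts⟩ := hslope s hs
    exact hts ▸ (isGreatest_legendreValues (hI ht)).bddAbove
  exact exists_exp_cbrt_bounds hl (fun n hn => abs_pathCost_obstacle_sub_le hJ
    (hC2.differentiableOn two_ne_zero) hn) hP

theorem theorem1 {Ω : Type*} [MeasurableSpace Ω] (P : Measure Ω) [IsProbabilityMeasure P]
    (X : ℕ → Ω → ℤ) (hmeas : ∀ i, Measurable (X i)) (hindep : iIndepFun X P)
    (hident : ∀ i, IdentDistrib (X i) (X 0) P P)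
    (hirr : ObstacleWalk.IsIrreducibleWalk X P) (haper : ObstacleWalk.IsAperiodicWalk X P)
    (Y : Ω → ℝ) (hY : Y = fun ω => (X 0 ω : ℝ))
    (σ δ : ℝ) (hσ : 0 < σ) (hδ : 0 < δ)
    (hmean : ∫ ω, Y ω ∂P = 0) (hvar : ∫ ω, Y ω ^ 2 ∂P = σ ^ 2)
    (hexp : Integrable (fun ω => Real.exp (δ * |Y ω|)) P)
    (a b : ℝ) (ha : ObstacleWalk.lowerTilt Y P < (a : EReal)) (hab : a < b)
    (hb : (b : EReal) < ObstacleWalk.upperTilt Y P)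
    (h : ℝ → ℝ) (hC2 : ContDiffOn ℝ 2 h (Set.Icc 0 1))
    (hnonneg : ∀ s ∈ Set.Icc (0 : ℝ) 1, 0 ≤ h s) (hconc : ConcaveOn ℝ (Set.Icc 0 1) h)
    (hneg : ∀ s ∈ Set.Icc (0 : ℝ) 1, ObstacleWalk.unitDeriv (ObstacleWalk.unitDeriv h) s < 0)
    (hslope : ∀ s ∈ Set.Icc (0 : ℝ) 1,
      ObstacleWalk.unitDeriv h s ∈ deriv (cgf Y P) '' Set.Icc a b)
    (h0 : h 0 = 0) :
    (∀ s ∈ Set.Icc (0 : ℝ) 1,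
      BddAbove (ObstacleWalk.legendreValues Y P (ObstacleWalk.unitDeriv h s))) ∧
    IntervalIntegrable (fun s => ObstacleWalk.rate Y P (ObstacleWalk.unitDeriv h s)) volume 0 1 ∧
    ∃ (cp cm : ℝ) (n₀ : ℕ), cm ≤ cp ∧ 0 < cm ∧ 1 ≤ n₀ ∧ ∀ n : ℕ, n₀ ≤ n →
      Real.exp (-cp * (n : ℝ) ^ (1 / 3 : ℝ)) ≤
        Real.exp ((n : ℝ) * ∫ s in (0 : ℝ)..1,
            ObstacleWalk.rate Y P (ObstacleWalk.unitDeriv h s)) *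
          P.real (ObstacleWalk.aboveEvent X h n) ∧
      Real.exp ((n : ℝ) * ∫ s in (0 : ℝ)..1,
            ObstacleWalk.rate Y P (ObstacleWalk.unitDeriv h s)) *
          P.real (ObstacleWalk.aboveEvent X h n) ≤
        Real.exp (-cm * (n : ℝ) ^ (1 / 3 : ℝ)) :=
  theorem1_general P X hmeas hindep hident hirr haper Y hY a b ha hb h hC2 hneg hslope h0
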